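/- \textbf{Conventions.} $\mathbb N=\{1,2,\dots\}$, $\mathcal S=\mathcal S(\mathbb R;\mathbb C)$ is the Schwartz space, $\widehat\varphi(\omega)=\int_{\mathbb R}\varphi(x)e^{-i\omega x}\,dx$ and $(\mathcal F^{-1}f)(x)=\frac1{2\pi}\int_{\mathbb R}f(\omega)e^{i\omega x}\,d\omega$. For $a,b\in\mathbb C\setminus\{0\}$ and $\gamma\in\mathbb C$ put $h_{a,b}^{\gamma}(\omega)=a|\omega|^{\gamma}$ for $\omega>0$, $h_{a,b}^{\gamma}(\omega)=b|\omega|^{\gamma}$ for $\omega<0$, and $h_{a,b}^\gamma(0)=0$. For $k\in\mathbb N$ and $\varphi\in\mathcal S$ put $$\Phi(\omega)=\frac{\widehat\varphi(\omega)-\sum_{j=0}^{k-1}\frac{\widehat\varphi^{(j)}(0)}{j!}\omega^j}{h_{a,b}^{\gamma}(-\omega)},\qquad \mathrm I_{a,b}^{(\gamma;k)*}\varphi=\mathcal F^{-1}\{\Phi\},$$ the inverse Fourier transform being that of tempered distributions: $\langle \mathcal F^{-1}\{\Phi\},\psi\rangle=\int_{\mathbb R}\Phi(\omega)\,(\mathcal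 F^{-1}\psi)(\omega)\,d\omega$ for $\psi\in\mathcal S$. "Around $x=0$" means on some punctured neighbourhood of $0$, and $L_p$ with $0<p<\infty$ denotes the measurable $f$ with $\int|f|^p<\infty$. \textbf{Theorem.} Let $a,b\in\mathbb C\setminus\{0\}$, $\gamma\in\mathbb C$ with $\mathrm{Re}\,\gamma>0$, and let $k$ be an integer with $k\ge\max(1,\lfloor\mathrm{Re}\,\gamma\rfloor)$. Let $\varphi\in\mathcal S$. Then the integrals defining $\mathrm I_{a,b}^{(\gamma;k)*}\varphi$ converge absolutely and define a tempered distribution, and this distribution is a continuous function away from $0$: there is $g:\mathbb R\to\mathbb C$, continuous on $\mathbb R\setminus\{0\}$, such that $\langle \mathrm I_{a,b}^{(\gamma;k)*}\varphi,\psi\rangle=\int g\psi$ (an absolutely convergent integral) for every $\psi\in\mathcal S$ with $0\notin\mathrm{supp}\,\psi$, and even for every $\psi\in\mathcal S$ if $k-\mathrm{Re}\,\gamma<1$. Write $(\mathrm I_{a,b}^{(\gamma;k)*}\varphi)(x)=g(x)$ for $x\ne0$. Moreover: (i) If $\mathrm{Re}\,\gamma\notin\mathbb N$ and $k=\lfloor\mathrm{Re}\,\gamma\rfloor$,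 then $g$ is bounded around $x=0$, $g\in L_p$ for all $p>\frac1{k+1-\mathrm{Re}\,\gamma}$, and there is $c>0$ with $|g(x)|\le c\,|x|^{-(k+1-\mathrm{Re}\,\gamma)}$ for all $|x|\ge1$. (ii) If $\gamma\in\mathbb N$, $h_{a,b}^{\gamma}(\omega)\equiv d\,\omega^{\gamma}$ for some $d\in\mathbb C$, and $k=\gamma$, then $g$ is bounded around $x=0$ and $g\in L_p$ for all $p>0$. (iii) If $\mathrm{Re}\,\gamma\in\mathbb N$ and $k=\mathrm{Re}\,\gamma$, but it is not the case that $\gamma\in\mathbb N$ and $h_{a,b}^{\gamma}(\omega)\equiv d\,\omega^{\gamma}$ for some $d\in\mathbb C$, then $\frac{|g(x)|}{\log|x|}$ is bounded around $x=0$, $g\in L_p$ for all $p>1$, and there is $c>0$ with $|g(x)|\le c\,\frac{1+\log|x|}{|x|}$ for all $|x|\ge1$. If in addition $\widehat\varphi^{(k-1)}(0)\neq0$, then $g$ is singular at $x=0$: it has no finite limit there, and if $\gamma\in\mathbb N$ then even $|g(x)|\to\infty$ as $x\to0$. (iv) If $\mathrm{Re}\,\gamma\notin\mathbb N$ and $k>\lfloor\mathrm{Re}\,\gamma\rfloor$,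 then $|x|^{k-\mathrm{Re}\,\gamma}|g(x)|$ is bounded around $x=0$, $g\in L_p$ for all $\frac1{k+1-\mathrm{Re}\,\gamma}<p<\frac1{k-\mathrm{Re}\,\gamma}$, and there is $c>0$ with $|g(x)|\le c\,|x|^{-(k+1-\mathrm{Re}\,\gamma)}$ for all $|x|\ge1$. (v) If $\mathrm{Re}\,\gamma\in\mathbb N$ and $k>\mathrm{Re}\,\gamma$, then $|x|^{k-\mathrm{Re}\,\gamma}|g(x)|$ is bounded around $x=0$, $g\in L_p$ for all $\frac1{k+1-\mathrm{Re}\,\gamma}<p<\frac1{k-\mathrm{Re}\,\gamma}$, and there is $c>0$ with $|g(x)|\le c\,\frac{1+\log|x|}{|x|^{k+1-\mathrm{Re}\,\gamma}}$ for all $|x|\ge1$. -/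

import Mathlib

open MeasureTheory Filter Topology

noncomputable section

namespace FracInt

/-- The Fourier transform `f̂(ω) = ∫ f(x) e^{-iωx} dx`. -/
def fourier (f : ℝ → ℂ) (ω : ℝ) : ℂ :=
  ∫ x : ℝ, f x * Complex.exp (-(Complex.I * ω * x))

/-- The inverse Fourier transform `(1/2π) ∫ f(ω) e^{iωx} dω`. -/
def fourierInv (f : ℝ → ℂ) (x : ℝ) : ℂ :=
  (1 / (2 * (Real.pi : ℂ))) * ∫ ω : ℝ, f ω * Complex.exp (Complex.I * ω * x)

/-- The homogeneous function `h_{a,b}^γ(ω) = a ω₊^γ + b ω₋^γ` (and `0` at `ω = 0`), where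
`ω_±^γ = |ω|^γ` if `±ω > 0` and `0` otherwise. -/
def homMultiplier (a b γ : ℂ) (ω : ℝ) : ℂ :=
  if 0 < ω then a * ((|ω| : ℝ) : ℂ) ^ γ
  else if ω < 0 then b * ((|ω| : ℝ) : ℂ) ^ γ
  else 0

/-- `γ` is a natural number and `h_{a,b}^γ(ω) = d ω^γ` for some constant `d`. -/
def IsPureInteger (a b γ : ℂ) : Prop :=
  ∃ n : ℕ, γ = n ∧ ∃ d : ℂ, ∀ ω : ℝ, homMultiplier a b γ ω = d * (ω : ℂ) ^ n

/-- The Fourier-domain symbol of the adjoint integrator applied to `φ`: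
`(φ̂(ω) - ∑_{j<k} φ̂^{(j)}(0) ω^j / j!) / h_{a,b}^γ(-ω)`. -/
def adjSymbol (a b γ : ℂ) (k : ℕ) (φ : SchwartzMap ℝ ℂ) (ω : ℝ) : ℂ :=
  (fourier φ ω - ∑ j ∈ Finset.range k,
      iteratedDeriv j (fourier φ) 0 / (j.factorial : ℂ) * (ω : ℂ) ^ j)
    / homMultiplier a b γ (-ω)

/-- The adjoint integrator `I_{a,b}^{(γ;k)*} φ = F⁻¹{adjSymbol}`. The symbol need not be
integrable, so the inverse Fourier transform is the one of tempered distributions: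
`⟨F⁻¹ Φ, ψ⟩ = ∫ Φ(ω) (F⁻¹ ψ)(ω) dω` for Schwartz `ψ`, with the bilinear pairing. -/
def adjIntegrator (a b γ : ℂ) (k : ℕ) (φ ψ : SchwartzMap ℝ ℂ) : ℂ :=
  ∫ ω : ℝ, adjSymbol a b γ k φ ω * fourierInv ψ ω

/-- The functional `u` on Schwartz functions is given at `ψ` by integration against `g`. -/
def RepresentedAt (u : SchwartzMap ℝ ℂ → ℂ) (g : ℝ → ℂ) (ψ : SchwartzMap ℝ ℂ) : Prop :=
  Integrable (fun x : ℝ => g x * ψ x) ∧ u ψ = ∫ x : ℝ, g x * ψ x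

/-- `f` is bounded on some punctured neighbourhood of `0`. -/
def BoundedNearZero (f : ℝ → ℝ) : Prop :=
  ∃ C : ℝ, ∀ᶠ x in 𝓝[≠] (0 : ℝ), |f x| ≤ C

/-- `g` has a non-removable singularity at `0`: it has no (finite) limit there. -/
def SingularAtZero (g : ℝ → ℂ) : Prop :=
  ¬ ∃ L : ℂ, Tendsto g (𝓝[≠] (0 : ℝ)) (𝓝 L)

end FracInt

end

/-!
Write `β = k - γ`. By Taylor's formula with integral remainder, the numerator of the symbol is
`ω ^ k` times the mean over `t ∈ (0, 1]`, with weight `(1 - t) ^ (k - 1) / (k - 1)!`, of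
`φ̂⁽ᵏ⁾(t ω)`, and `ω ^ k / h(-ω)` is homogeneous of degree `β`. Hence
`g x = ∫₀¹ (1 - t) ^ (k - 1) / (k - 1)! * t ^ (-(β + 1)) * η (x / t) dt`, where `η` is the inverse
Fourier transform of a Schwartz function times a homogeneous function of degree `β`. Such an `η`
is `O((1 + |x|) ^ (-(Re β + 1)))`, so that `g x` is bounded by `∫₀¹ (t + |x|) ^ (-(Re β + 1)) dt`,
from which all the sizes can be read off: near `0` the integral is bounded, logarithmic, or of
order `|x| ^ (-Re β)` according to the sign of `Re β`.

If `β = 0`, then `g x = η 0 * ∫₀¹ (1 - t) ^ (k - 1) / (k - 1)! * (t + |x|)⁻¹ dt + O(1)`, and `η 0`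
is a multiple of `φ̂⁽ᵏ⁻¹⁾(0)`, the factor vanishing exactly in the pure power case; there `η` is
moreover a Schwartz function, so `g` is bounded and decays rapidly. If only `Re β = 0`, a limit of
`g` at the origin is incompatible with the behaviour of the symbol at infinity, where it is
asymptotic to `-φ̂⁽ᵏ⁻¹⁾(0) / (k - 1)!` times a homogeneous function of degree `β - 1`.
-/

noncomputable section

namespace FracInt

open Set FourierTransform

/-! ### The angular-frequency Fourier transform -/

/-- Dilation `f ↦ f (c · )` of Schwartz functions by a nonzero real `c`. -/
def schwartzDilate (c : ℝˣ) : SchwartzMap ℝ ℂ →L[ℂ] SchwartzMap ℝ ℂ :=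
  SchwartzMap.compCLMOfContinuousLinearEquiv ℂ (ContinuousLinearEquiv.smulLeft c)

@[simp]
theorem schwartzDilate_apply (c : ℝˣ) (f : SchwartzMap ℝ ℂ) (x : ℝ) :
    schwartzDilate c f x = f (c * x) := rfl

/-- The factor `2π` between ordinary and angular frequency. -/
def twoPi : ℝˣ := Units.mk0 (2 * Real.pi) Real.two_pi_pos.ne'

theorem coe_twoPi : (twoPi : ℝ) = 2 * Real.pi := rfl

theorem twoPi_complex_ne_zero : ((twoPi : ℝ) : ℂ) ≠ 0 :=
  Complex.ofReal_ne_zero.2 twoPi.ne_zero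

theorem fourier_eq_fourierTransform (f : ℝ → ℂ) (ω : ℝ) :
    fourier f ω = 𝓕 f ((twoPi : ℝ)⁻¹ * ω) := by
  rw [Real.fourier_real_eq_integral_exp_smul, fourier]
  congr! 2 with x
  rw [smul_eq_mul, mul_comm]
  congr 2
  have := twoPi_complex_ne_zero
  simp only [coe_twoPi, Complex.ofReal_mul, Complex.ofReal_ofNat] at this
  push_cast [coe_twoPi]
  field_simp

theorem fourierInv_eq_fourierTransformInv (f : ℝ → ℂ) (x : ℝ) :
    fourierInv f x = ((twoPi : ℝ) : ℂ)⁻¹ * 𝓕⁻ f ((twoPi : ℝ)⁻¹ * x) := by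
  rw [Real.fourierInv_eq', fourierInv, one_div]
  congr! 3 with ω
  · simp [coe_twoPi]
  · rw [smul_eq_mul, mul_comm]
    congr 2
    have := twoPi_complex_ne_zero
    simp only [coe_twoPi, Complex.ofReal_mul, Complex.ofReal_ofNat] at this
    simp only [RCLike.inner_apply, conj_trivial]
    push_cast [coe_twoPi]
    field_simp

/-- The Fourier transform in angular frequency, as an operator on Schwartz functions. -/
def schwartzFourier (φ : SchwartzMap ℝ ℂ) : SchwartzMap ℝ ℂ :=
  schwartzDilate twoPi⁻¹ (𝓕 φ)

theorem coe_schwartzFourier (φ : SchwartzMap ℝ ℂ) : ⇑(schwartzFourier φ) = fourier φ := by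
  ext ω
  simp [schwartzFourier, SchwartzMap.fourier_coe, fourier_eq_fourierTransform]

/-- The inverse Fourier transform in angular frequency, as an operator on Schwartz functions. -/
def schwartzFourierInv : SchwartzMap ℝ ℂ →L[ℂ] SchwartzMap ℝ ℂ :=
  ((twoPi : ℝ) : ℂ)⁻¹ • (schwartzDilate twoPi⁻¹).comp (fourierInvCLM ℂ (SchwartzMap ℝ ℂ))

theorem coe_schwartzFourierInv (ψ : SchwartzMap ℝ ℂ) : ⇑(schwartzFourierInv ψ) = fourierInv ψ := by
  ext x
  simp [schwartzFourierInv, SchwartzMap.fourierInv_coe, fourierInv_eq_fourierTransformInv]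

theorem schwartzFourierInv_surjective : Function.Surjective schwartzFourierInv := fun θ => by
  refine ⟨((twoPi : ℝ) : ℂ) • 𝓕 (schwartzDilate twoPi θ), ?_⟩
  ext x
  simp [schwartzFourierInv, fourierInv_fourier_eq]

theorem norm_exp_I_mul_mul (ω x : ℝ) : ‖Complex.exp (Complex.I * ω * x)‖ = 1 := by
  rw [mul_assoc, mul_comm, ← Complex.ofReal_mul, Complex.norm_exp_ofReal_mul_I]

theorem integrable_mul_exp {f : ℝ → ℂ} (hf : Integrable f) (x : ℝ) :
    Integrable fun ω : ℝ => f ω * Complex.exp (Complex.I * ω * x) :=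
  hf.mul_bdd (c := 1) (by fun_prop) (by simp [norm_exp_I_mul_mul])

theorem continuous_fourierInv {f : ℝ → ℂ} (hf : Integrable f) : Continuous (fourierInv f) := by
  refine continuous_const.mul (continuous_of_dominated (bound := fun ω => ‖f ω‖)
    (fun x => (integrable_mul_exp hf x).1) (fun x => ?_) hf.norm
    (Eventually.of_forall fun ω => by fun_prop))
  simp [norm_exp_I_mul_mul]

theorem norm_one_div_two_pi_le_one : ‖1 / (2 * (Real.pi : ℂ))‖ ≤ 1 := by
  rw [norm_div, norm_one, norm_mul, Complex.norm_ofNat, Complex.norm_real,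
    Real.norm_of_nonneg Real.pi_pos.le, div_le_one Real.two_pi_pos]
  linarith [Real.pi_gt_three]

theorem norm_fourierInv_le_norm_integral (f : ℝ → ℂ) (x : ℝ) :
    ‖fourierInv f x‖ ≤ ‖∫ ω : ℝ, f ω * Complex.exp (Complex.I * ω * x)‖ := by
  rw [fourierInv, norm_mul]
  exact mul_le_of_le_one_left (norm_nonneg _) norm_one_div_two_pi_le_one

theorem norm_fourierInv_le (f : ℝ → ℂ) (x : ℝ) : ‖fourierInv f x‖ ≤ ∫ ω, ‖f ω‖ := by
  refine (norm_fourierInv_le_norm_integral f x).trans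
    ((norm_integral_le_integral_norm _).trans_eq ?_)
  simp only [norm_mul, norm_exp_I_mul_mul, mul_one]

theorem fourierInv_const_mul (c : ℂ) (f : ℝ → ℂ) (x : ℝ) :
    fourierInv (fun ω => c * f ω) x = c * fourierInv f x := by
  simp only [fourierInv, mul_assoc c, integral_const_mul]
  ring

theorem fourierInv_comp_mul_left (f : ℝ → ℂ) {t : ℝ} (ht : 0 < t) (x : ℝ) :
    fourierInv (fun ω => f (t * ω)) x = (t : ℂ)⁻¹ * fourierInv f (x / t) := by
  have ht0 : (t : ℂ) ≠ 0 := Complex.ofReal_ne_zero.2 ht.ne'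
  have hsubst := Measure.integral_comp_mul_left
    (fun u : ℝ => f u * Complex.exp (Complex.I * u * (x / t : ℝ))) t
  rw [abs_of_pos (inv_pos.2 ht), Complex.real_smul] at hsubst
  have hphase (ω : ℝ) : Complex.I * (t * ω : ℝ) * (x / t : ℝ) = Complex.I * ω * x := by
    push_cast
    field_simp
  simp only [hphase, Complex.ofReal_inv] at hsubst
  rw [fourierInv, hsubst, fourierInv]
  ring

theorem integral_mul_fourierInv {f g : ℝ → ℂ} (hf : Integrable f) (hg : Integrable g) :
    ∫ ω, f ω * fourierInv g ω = ∫ x, fourierInv f x * g x := by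
  have hint : Integrable (fun p : ℝ × ℝ => f p.1 * g p.2 * Complex.exp (Complex.I * p.1 * p.2))
      (volume.prod volume) :=
    (hf.mul_prod hg).mul_bdd (c := 1) (by fun_prop) (by simp [norm_exp_I_mul_mul])
  have hleft (ω : ℝ) : f ω * fourierInv g ω = 1 / (2 * (Real.pi : ℂ)) *
      ∫ x : ℝ, f ω * g x * Complex.exp (Complex.I * ω * x) := by
    simp only [mul_assoc (f ω), integral_const_mul, fourierInv]
    rw [mul_left_comm]
    simp only [mul_right_comm]
  have hright (x : ℝ) : fourierInv f x * g x = 1 / (2 * (Real.pi : ℂ)) *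
      ∫ ω : ℝ, f ω * g x * Complex.exp (Complex.I * ω * x) := by
    rw [fourierInv, mul_assoc, ← integral_mul_const]
    simp only [mul_right_comm]
  simp only [hleft, hright, integral_const_mul]
  rw [integral_integral_swap hint]

/-! ### Powers and rapid decay -/

theorem integrable_abs_rpow_mul_one_add_rpow {p m : ℝ} (hp : -1 < p) (hm : p + 1 < m) :
    Integrable fun x : ℝ => |x| ^ p * (1 + |x|) ^ (-m) := by
  have hmeas : Measurable fun y : ℝ => y ^ p * (1 + y) ^ (-m) := by fun_prop
  refine (integrable_fun_norm_addHaar volume (f := fun y : ℝ => y ^ p * (1 + y) ^ (-m))).2 ?_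
  simp only [Module.finrank_self, Nat.sub_self, pow_zero, one_smul]
  rw [← Ioc_union_Ioi_eq_Ioi zero_le_one]
  have hnonneg {y : ℝ} (hy : 0 < y) : ‖y ^ p * (1 + y) ^ (-m)‖ = y ^ p * (1 + y) ^ (-m) :=
    Real.norm_of_nonneg (by positivity)
  refine IntegrableOn.union
    ((intervalIntegral.intervalIntegrable_rpow' (a := 0) (b := 1) hp).1.mono'
      hmeas.aestronglyMeasurable ((ae_restrict_iff' measurableSet_Ioc).2 (ae_of_all _ ?_)))
    ((integrableOn_Ioi_rpow_of_lt (a := p - m) (by linarith) one_pos).mono'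
      hmeas.aestronglyMeasurable ((ae_restrict_iff' measurableSet_Ioi).2 (ae_of_all _ ?_)))
  · intro y hy
    rw [hnonneg hy.1]
    exact mul_le_of_le_one_right (Real.rpow_nonneg hy.1.le p)
      (Real.rpow_le_one_of_one_le_of_nonpos (by linarith [hy.1]) (by linarith))
  · intro y (hy : 1 < y)
    have hy0 : 0 < y := one_pos.trans hy
    rw [hnonneg hy0, sub_eq_add_neg, Real.rpow_add hy0]
    exact mul_le_mul_of_nonneg_left
      (Real.rpow_le_rpow_of_nonpos hy0 (by linarith) (by linarith)) (by positivity)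

theorem exists_norm_schwartz_le (m : ℝ) (f : SchwartzMap ℝ ℂ) :
    ∃ C, 0 ≤ C ∧ ∀ x : ℝ, ‖f x‖ ≤ C * (1 + |x|) ^ (-m) := by
  have hbound := SchwartzMap.one_add_le_sup_seminorm_apply (𝕜 := ℂ) (m := (⌈m⌉₊, 0)) le_rfl le_rfl f
  simp only [norm_iteratedFDeriv_zero, Real.norm_eq_abs] at hbound
  refine ⟨_, (by positivity : _ ≤ _).trans (hbound 0), fun x => ?_⟩
  rw [Real.rpow_neg (by positivity), ← div_eq_mul_inv, le_div_iff₀ (by positivity), mul_comm]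
  refine (mul_le_mul_of_nonneg_right ?_ (norm_nonneg _)).trans (hbound x)
  rw [← Real.rpow_natCast]
  exact Real.rpow_le_rpow_of_exponent_le (by linarith [abs_nonneg x]) (Nat.le_ceil m)

theorem integrable_abs_rpow_mul_schwartz {p : ℝ} (hp : -1 < p) (f : SchwartzMap ℝ ℂ) :
    Integrable fun ω : ℝ => |ω| ^ p * ‖f ω‖ := by
  obtain ⟨C, -, hC⟩ := exists_norm_schwartz_le (p + 2) f
  refine ((integrable_abs_rpow_mul_one_add_rpow hp (m := p + 2) (by linarith)).const_mul C).mono'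
    (Measurable.aestronglyMeasurable (by fun_prop)) (ae_of_all _ fun ω => ?_)
  rw [Real.norm_of_nonneg (by positivity), mul_left_comm]
  gcongr
  exact hC ω

theorem exists_norm_le_one_add_rpow {η : ℝ → ℂ} {s M C : ℝ} (hM : ∀ x, ‖η x‖ ≤ M)
    (hs : 0 ≤ s) (hC : ∀ x : ℝ, x ≠ 0 → ‖η x‖ ≤ C * |x| ^ (-s)) :
    ∃ C', 0 ≤ C' ∧ ∀ x : ℝ, ‖η x‖ ≤ C' * (1 + |x|) ^ (-s) := by
  have hM0 : 0 ≤ M := (norm_nonneg _).trans (hM 0)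
  have hC0 : 0 ≤ C := by simpa using (norm_nonneg _).trans (hC 1 one_ne_zero)
  refine ⟨(M + C) * 2 ^ s, by positivity, fun x => ?_⟩
  have hhalf : (2 : ℝ) ^ s * (1 + |x|) ^ (-s) = ((1 + |x|) / 2) ^ (-s) := by
    rw [Real.div_rpow (by positivity) zero_le_two, Real.rpow_neg zero_le_two, div_inv_eq_mul,
      mul_comm]
  rw [mul_assoc, hhalf]
  rcases le_total |x| 1 with hx | hx
  · have hone : 1 ≤ ((1 + |x|) / 2) ^ (-s) :=
      Real.one_le_rpow_of_pos_of_le_one_of_nonpos (by positivity) (by linarith) (by linarith)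
    exact (hM x).trans (by nlinarith)
  · refine (hC x (abs_pos.1 (by linarith))).trans ?_
    gcongr ?_ * ?_
    · linarith
    · exact Real.rpow_le_rpow_of_nonpos (by positivity) (by linarith) (by linarith)

theorem aestronglyMeasurable_of_continuousOn_compl_zero {g : ℝ → ℂ} (hg : ContinuousOn g {0}ᶜ) :
    AEStronglyMeasurable g := by
  have h := hg.aestronglyMeasurable (μ := volume) (measurableSet_singleton 0).compl
  rwa [Measure.restrict_eq_self_of_ae_mem (s := {0}ᶜ) (Measure.ae_ne volume 0)] at h

theorem memLp_of_rpow_bound {g : ℝ → ℂ} (hg : ContinuousOn g {0}ᶜ) {C u r p : ℝ} (hp : 0 < p)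
    (hu : u * p < 1) (hr : 1 < (u + r) * p)
    (hbound : ∀ x : ℝ, x ≠ 0 → ‖g x‖ ≤ C * (|x| ^ (-u) * (1 + |x|) ^ (-r))) :
    MemLp g (ENNReal.ofReal p) := by
  have hm := aestronglyMeasurable_of_continuousOn_compl_zero hg
  have hC : 0 ≤ C := nonneg_of_mul_nonneg_left
    ((norm_nonneg _).trans (hbound 1 one_ne_zero)) (by positivity)
  rw [← integrable_norm_rpow_iff hm (by simpa using hp) (by simp), ENNReal.toReal_ofReal hp.le]
  refine ((integrable_abs_rpow_mul_one_add_rpow (p := -u * p) (m := r * p) (by linarith)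
    (by linarith)).const_mul (C ^ p)).mono' (hm.norm.aemeasurable.pow_const p).aestronglyMeasurable
    ((Measure.ae_ne volume 0).mono fun x hx => ?_)
  rw [Real.norm_of_nonneg (by positivity), ← neg_mul, Real.rpow_mul (abs_nonneg x),
    Real.rpow_mul (by positivity), ← Real.mul_rpow (by positivity) (by positivity),
    ← Real.mul_rpow hC (by positivity)]
  exact Real.rpow_le_rpow (norm_nonneg _) (hbound x hx) hp.le

/-- `∫₀¹ (t + y)^{-s} dt`, the size at `|x| = y` of a mean over `t ∈ (0, 1]` of functions
bounded by `(t + |x|)^{-s}`. -/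
def kernelIntegral (s y : ℝ) : ℝ :=
  ∫ t in (0 : ℝ)..1, (t + y) ^ (-s)

section KernelIntegral

variable {s u r t y : ℝ}

theorem intervalIntegrable_add_rpow (hy : 0 < y) (s : ℝ) :
    IntervalIntegrable (fun t : ℝ => (t + y) ^ (-s)) volume 0 1 := by
  refine ContinuousOn.intervalIntegrable fun t ht => ContinuousAt.continuousWithinAt ?_
  rw [uIcc_of_le zero_le_one] at ht
  exact (continuousAt_id.add continuousAt_const).rpow_const
    (Or.inl (add_pos_of_nonneg_of_pos ht.1 hy).ne')

theorem add_rpow_neg_le (ht : t ∈ Ioc (0 : ℝ) 1) (hy : 0 < y) (hu : 0 ≤ u) (hr : 0 ≤ r) :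
    (t + y) ^ (-(u + r)) ≤ t ^ (-r) * (y ^ (-u) * (1 + y) ^ (-r)) := by
  have hty : 0 < t + y := add_pos ht.1 hy
  rw [neg_add, Real.rpow_add hty, mul_left_comm, ← Real.mul_rpow ht.1.le (by positivity)]
  gcongr ?_ * ?_
  · exact Real.rpow_le_rpow_of_nonpos hy (by linarith [ht.1]) (by linarith)
  · refine Real.rpow_le_rpow_of_nonpos (mul_pos ht.1 (by positivity)) ?_ (by linarith)
    nlinarith [ht.2]

theorem kernelIntegral_le_rpow (hs : 0 ≤ s) (hy : 0 < y) : kernelIntegral s y ≤ y ^ (-s) := by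
  have h := intervalIntegral.integral_mono_on zero_le_one (intervalIntegrable_add_rpow hy s)
    (intervalIntegrable_const (c := y ^ (-s))) fun t ht =>
      Real.rpow_le_rpow_of_nonpos hy (by linarith [ht.1]) (by linarith)
  simpa [kernelIntegral] using h

theorem kernelIntegral_le_mul_rpow (hu : 0 ≤ u) (hr : 0 ≤ r) (hr1 : r < 1) (hy : 0 < y) :
    kernelIntegral (u + r) y ≤ 1 / (1 - r) * (y ^ (-u) * (1 + y) ^ (-r)) := by
  have hint := (intervalIntegral.intervalIntegrable_rpow' (a := 0) (b := 1)
    (neg_lt_neg hr1)).mul_const (y ^ (-u) * (1 + y) ^ (-r))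
  refine (intervalIntegral.integral_mono_on_of_le_Ioo zero_le_one (intervalIntegrable_add_rpow hy _)
    hint fun t ht => add_rpow_neg_le ⟨ht.1, ht.2.le⟩ hy hu hr).trans_eq ?_
  rw [intervalIntegral.integral_mul_const, integral_rpow (Or.inl (by linarith)),
    Real.zero_rpow (by linarith), Real.one_rpow, sub_zero, neg_add_eq_sub]

theorem kernelIntegral_eq (s y : ℝ) : kernelIntegral s y = ∫ t in y..1 + y, t ^ (-s) := by
  rw [kernelIntegral, intervalIntegral.integral_comp_add_right (fun t => t ^ (-s)), zero_add]

theorem kernelIntegral_le_of_one_lt (hs : 1 < s) (hy : 0 < y) :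
    kernelIntegral s y ≤ 1 / (s - 1) * y ^ (1 - s) := by
  have hnot : (0 : ℝ) ∉ uIcc y (1 + y) := by
    rw [uIcc_of_le (by linarith)]
    exact fun h => hy.not_ge h.1
  rw [kernelIntegral_eq, integral_rpow (Or.inr ⟨by linarith, hnot⟩), neg_add_eq_sub,
    ← neg_div_neg_eq, neg_sub, neg_sub, one_div_mul_eq_div]
  gcongr
  linarith [Real.rpow_nonneg (add_pos one_pos hy).le (1 - s)]

theorem kernelIntegral_one (hy : 0 < y) :
    kernelIntegral 1 y = Real.log (1 + y) - Real.log y := by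
  rw [kernelIntegral_eq, ← Real.log_div (by positivity) hy.ne',
    ← integral_inv_of_pos hy (by positivity)]
  simp only [Real.rpow_neg_one]

end KernelIntegral

/-! ### Homogeneous multipliers -/

@[elab_as_elim]
theorem real_sign_cases {P : ℝ → Prop} (zero : P 0) (pos : ∀ ω, 0 < ω → P ω)
    (neg : ∀ ω, 0 < ω → P (-ω)) (ω : ℝ) : P ω := by
  rcases lt_trichotomy ω 0 with h | rfl | h
  · simpa using neg (-ω) (by linarith)
  · exact zero
  · exact pos ω h

section HomMultiplier

variable (p q β : ℂ)

theorem homMultiplier_of_pos {ω : ℝ} (hω : 0 < ω) : homMultiplier p q β ω = p * (ω : ℂ) ^ β := by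
  rw [homMultiplier, if_pos hω, abs_of_pos hω]

theorem homMultiplier_neg_of_pos {ω : ℝ} (hω : 0 < ω) :
    homMultiplier p q β (-ω) = q * (ω : ℂ) ^ β := by
  rw [homMultiplier, if_neg (by linarith), if_pos (by linarith), abs_neg, abs_of_pos hω]

@[simp]
theorem homMultiplier_zero : homMultiplier p q β 0 = 0 := by
  simp [homMultiplier]

theorem measurable_homMultiplier : Measurable (homMultiplier p q β) :=
  Measurable.ite (measurableSet_lt measurable_const measurable_id) (by fun_prop)
    (Measurable.ite (measurableSet_lt measurable_id measurable_const) (by fun_prop) (by fun_prop))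

theorem norm_homMultiplier_le (ω : ℝ) :
    ‖homMultiplier p q β ω‖ ≤ (‖p‖ + ‖q‖) * |ω| ^ β.re := by
  induction ω using real_sign_cases with
  | zero => rw [homMultiplier_zero, norm_zero]; positivity
  | pos ω hω =>
    rw [homMultiplier_of_pos p q β hω, norm_mul, Complex.norm_cpow_eq_rpow_re_of_pos hω,
      abs_of_pos hω]
    gcongr
    exact le_add_of_nonneg_right (norm_nonneg q)
  | neg ω hω =>
    rw [homMultiplier_neg_of_pos p q β hω, norm_mul, Complex.norm_cpow_eq_rpow_re_of_pos hω,
      abs_neg, abs_of_pos hω]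
    gcongr
    exact le_add_of_nonneg_left (norm_nonneg p)

theorem homMultiplier_mul_left {t : ℝ} (ht : 0 < t) (ω : ℝ) :
    homMultiplier p q β (t * ω) = (t : ℂ) ^ β * homMultiplier p q β ω := by
  induction ω using real_sign_cases with
  | zero => simp
  | pos ω hω =>
    rw [homMultiplier_of_pos p q β hω, homMultiplier_of_pos p q β (mul_pos ht hω),
      Complex.ofReal_mul, Complex.mul_cpow_ofReal_nonneg ht.le hω.le, mul_left_comm]
  | neg ω hω =>
    rw [mul_neg, homMultiplier_neg_of_pos p q β hω, homMultiplier_neg_of_pos p q β (mul_pos ht hω),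
      Complex.ofReal_mul, Complex.mul_cpow_ofReal_nonneg ht.le hω.le, mul_left_comm]

theorem pow_div_homMultiplier_neg (a b γ : ℂ) (k : ℕ) (ω : ℝ) :
    (ω : ℂ) ^ k / homMultiplier a b γ (-ω) = homMultiplier b⁻¹ ((-1) ^ k / a) (k - γ) ω := by
  induction ω using real_sign_cases with
  | zero => simp
  | pos ω hω =>
    rw [homMultiplier_neg_of_pos a b γ hω, homMultiplier_of_pos _ _ _ hω,
      Complex.cpow_sub _ _ (Complex.ofReal_ne_zero.2 hω.ne'), Complex.cpow_natCast]
    ring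
  | neg ω hω =>
    rw [neg_neg, homMultiplier_of_pos a b γ hω, homMultiplier_neg_of_pos _ _ _ hω,
      Complex.cpow_sub _ _ (Complex.ofReal_ne_zero.2 hω.ne'), Complex.cpow_natCast,
      Complex.ofReal_neg, neg_pow]
    ring

end HomMultiplier

/-! ### Half-line Fourier integrals -/

/-- The integrand `ω^β f(ω) e^{iωx}` of a Fourier integral over the half-line `ω > 0`. -/
def halfLineIntegrand (β : ℂ) (f : SchwartzMap ℝ ℂ) (x ω : ℝ) : ℂ :=
  (ω : ℂ) ^ β * f ω * Complex.exp (Complex.I * ω * x)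

/-- The Euler-type operator `f ↦ β f + ω f'`, which satisfies
`(ω^β f)' = ω^{β-1} (β f + ω f')`. -/
def eulerOp (β : ℂ) : SchwartzMap ℝ ℂ →L[ℂ] SchwartzMap ℝ ℂ :=
  β • ContinuousLinearMap.id ℂ (SchwartzMap ℝ ℂ) +
    (SchwartzMap.smulLeftCLM ℂ fun ω : ℝ => (ω : ℂ)).comp (SchwartzMap.derivCLM ℂ ℂ)

theorem eulerOp_apply (β : ℂ) (f : SchwartzMap ℝ ℂ) (ω : ℝ) :
    eulerOp β f ω = β * f ω + ω * deriv f ω := by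
  simp [eulerOp, SchwartzMap.smulLeftCLM_apply_apply
    (g := fun ω : ℝ => (ω : ℂ)) (by fun_prop)]

theorem norm_halfLineIntegrand (β : ℂ) (f : SchwartzMap ℝ ℂ) (x : ℝ) {ω : ℝ} (hω : 0 < ω) :
    ‖halfLineIntegrand β f x ω‖ = ω ^ β.re * ‖f ω‖ := by
  rw [halfLineIntegrand, norm_mul, norm_exp_I_mul_mul, mul_one, norm_mul,
    Complex.norm_cpow_eq_rpow_re_of_pos hω]

theorem exists_norm_halfLineIntegrand_le (β : ℂ) (f : SchwartzMap ℝ ℂ) {r : ℝ}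
    (hr : r ≤ β.re) :
    ∃ C, 0 ≤ C ∧ ∀ x ω : ℝ, 0 < ω → ‖halfLineIntegrand β f x ω‖ ≤ C * ω ^ r := by
  obtain ⟨C, hC0, hC⟩ := exists_norm_schwartz_le (β.re - r) f
  refine ⟨C, hC0, fun x ω hω => ?_⟩
  have hdecay : (1 + |ω|) ^ (-(β.re - r)) ≤ ω ^ (-(β.re - r)) :=
    Real.rpow_le_rpow_of_nonpos hω (by linarith [le_abs_self ω]) (by linarith)
  calc ‖halfLineIntegrand β f x ω‖ = ω ^ β.re * ‖f ω‖ := norm_halfLineIntegrand β f x hω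
    _ ≤ ω ^ β.re * (C * ω ^ (-(β.re - r))) := by
      gcongr
      exact (hC ω).trans (mul_le_mul_of_nonneg_left hdecay hC0)
    _ = C * ω ^ r := by
      rw [mul_left_comm, ← Real.rpow_add hω]
      ring_nf

theorem hasDerivAt_halfLineIntegrand (β : ℂ) (f : SchwartzMap ℝ ℂ) (x : ℝ) {ω : ℝ} (hω : 0 < ω) :
    HasDerivAt (halfLineIntegrand β f x)
      (halfLineIntegrand (β - 1) (eulerOp β f) x ω
        + Complex.I * x * halfLineIntegrand β f x ω) ω := by
  have hω0 : (ω : ℂ) ≠ 0 := Complex.ofReal_ne_zero.2 hω.ne'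
  have hpow : HasDerivAt (fun ω : ℝ => (ω : ℂ) ^ β) (β * (ω : ℂ) ^ (β - 1)) ω :=
    (Complex.hasStrictDerivAt_cpow_const (Complex.ofReal_mem_slitPlane.2 hω)).hasDerivAt.comp_ofReal
  have hexp : HasDerivAt (fun ω : ℝ => Complex.exp (Complex.I * ω * x))
      (Complex.exp (Complex.I * ω * x) * (Complex.I * x)) ω := by
    have hlin : HasDerivAt (fun ω : ℂ => Complex.I * ω * x) (Complex.I * x) (ω : ℂ) := by
      simpa using ((hasDerivAt_id (ω : ℂ)).const_mul Complex.I).mul_const (x : ℂ)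
    exact hlin.cexp.comp_ofReal
  refine ((hpow.mul f.differentiableAt.hasDerivAt).mul hexp).congr_deriv ?_
  simp only [halfLineIntegrand, eulerOp_apply, Pi.mul_apply, Complex.cpow_sub _ _ hω0,
    Complex.cpow_one]
  field_simp

section HalfLineIntegral

variable (β : ℂ) (f : SchwartzMap ℝ ℂ) (x : ℝ) {δ : ℝ}

theorem continuousOn_halfLineIntegrand : ContinuousOn (halfLineIntegrand β f x) (Ioi 0) :=
  fun _ hω => (hasDerivAt_halfLineIntegrand β f x hω).continuousAt.continuousWithinAt

theorem integrableOn_halfLineIntegrand_Ioi (hδ : 0 < δ) :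
    IntegrableOn (halfLineIntegrand β f x) (Ioi δ) := by
  obtain ⟨C, -, hC⟩ := exists_norm_halfLineIntegrand_le β f (min_le_left β.re (-2))
  refine ((integrableOn_Ioi_rpow_of_lt ((min_le_right β.re (-2)).trans_lt (by norm_num))
    hδ).const_mul C).mono' (((continuousOn_halfLineIntegrand β f x).mono
      (Ioi_subset_Ioi hδ.le)).aestronglyMeasurable measurableSet_Ioi) ?_
  exact (ae_restrict_iff' measurableSet_Ioi).2 (ae_of_all _ fun ω hω => hC x ω (hδ.trans hω))

theorem integrableOn_halfLineIntegrand (hβ : -1 < β.re) :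
    IntegrableOn (halfLineIntegrand β f x) (Ioi 0) := by
  refine (integrable_abs_rpow_mul_schwartz hβ f).integrableOn.mono'
    ((continuousOn_halfLineIntegrand β f x).aestronglyMeasurable measurableSet_Ioi)
    ((ae_restrict_iff' measurableSet_Ioi).2 (ae_of_all _ fun ω (hω : 0 < ω) => ?_))
  rw [norm_halfLineIntegrand β f x hω, abs_of_pos hω]

theorem tendsto_halfLineIntegrand_atTop : Tendsto (halfLineIntegrand β f x) atTop (𝓝 0) := by
  obtain ⟨C, -, hC⟩ := exists_norm_halfLineIntegrand_le β f (min_le_left β.re (-2))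
  refine squeeze_zero_norm' ((eventually_gt_atTop 0).mono fun ω hω => hC x ω hω) ?_
  have hneg : 0 < -min β.re (-2) := by linarith [min_le_right β.re (-2)]
  simpa using (tendsto_rpow_neg_atTop hneg).const_mul C

theorem I_mul_mul_integral_halfLineIntegrand (hδ : 0 < δ) :
    Complex.I * x * ∫ ω in Ioi δ, halfLineIntegrand β f x ω =
      -halfLineIntegrand β f x δ - ∫ ω in Ioi δ, halfLineIntegrand (β - 1) (eulerOp β f) x ω := by
  have hEuler := integrableOn_halfLineIntegrand_Ioi (β - 1) (eulerOp β f) x hδ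
  have hphase := (integrableOn_halfLineIntegrand_Ioi β f x hδ).const_mul (Complex.I * x)
  have hparts := integral_Ioi_of_hasDerivAt_of_tendsto'
    (fun ω (hω : δ ≤ ω) => hasDerivAt_halfLineIntegrand β f x (hδ.trans_le hω))
    (hEuler.add hphase) (tendsto_halfLineIntegrand_atTop β f x)
  rw [integral_add hEuler hphase, integral_const_mul] at hparts
  linear_combination hparts

end HalfLineIntegral

theorem exists_norm_halfLine_tail_le_of_lt_neg_one {β : ℂ} (hβ : β.re < -1)
    (f : SchwartzMap ℝ ℂ) :
    ∃ C, 0 ≤ C ∧ ∀ x : ℝ, x ≠ 0 →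
      ‖∫ ω in Ioi |x|⁻¹, halfLineIntegrand β f x ω‖ ≤ C * |x| ^ (-(β.re + 1)) := by
  obtain ⟨C, hC0, hC⟩ := exists_norm_halfLineIntegrand_le β f le_rfl
  refine ⟨C / -(β.re + 1), div_nonneg hC0 (by linarith), fun x hx => ?_⟩
  have hx0 : 0 < |x| := abs_pos.2 hx
  calc ‖∫ ω in Ioi |x|⁻¹, halfLineIntegrand β f x ω‖ ≤ ∫ ω in Ioi |x|⁻¹, C * ω ^ β.re :=
      norm_integral_le_of_norm_le
        ((integrableOn_Ioi_rpow_of_lt hβ (inv_pos.2 hx0)).const_mul C)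
        ((ae_restrict_iff' measurableSet_Ioi).2 (ae_of_all _ fun ω hω =>
          hC x ω ((inv_pos.2 hx0).trans hω)))
    _ = C / -(β.re + 1) * |x| ^ (-(β.re + 1)) := by
      rw [integral_const_mul, integral_Ioi_rpow_of_lt hβ (inv_pos.2 hx0), Real.inv_rpow hx0.le,
        ← Real.rpow_neg hx0.le, neg_div, ← div_neg, mul_div_left_comm, mul_comm]

/-- Each integration by parts lowers the exponent by one and gains a factor `1/|x|`. -/
theorem exists_norm_halfLine_tail_le (β : ℂ) (f : SchwartzMap ℝ ℂ) :
    ∃ C, 0 ≤ C ∧ ∀ x : ℝ, x ≠ 0 →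
      ‖∫ ω in Ioi |x|⁻¹, halfLineIntegrand β f x ω‖ ≤ C * |x| ^ (-(β.re + 1)) := by
  obtain ⟨N, hN⟩ := exists_nat_gt (β.re + 1)
  induction N generalizing β f with
  | zero =>
    rw [Nat.cast_zero] at hN
    exact exists_norm_halfLine_tail_le_of_lt_neg_one (by linarith) f
  | succ N ih =>
    obtain ⟨C₁, hC₁, hboundary⟩ := exists_norm_halfLineIntegrand_le β f le_rfl
    obtain ⟨C₂, hC₂, htail⟩ := ih (β - 1) (eulerOp β f)
      (by push_cast at hN; simp only [Complex.sub_re, Complex.one_re]; linarith)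
    refine ⟨C₁ + C₂, by positivity, fun x hx => ?_⟩
    have hx0 : 0 < |x| := abs_pos.2 hx
    have hpow : |x| ^ (-β.re) = |x| * |x| ^ (-(β.re + 1)) := by
      rw [mul_comm, ← Real.rpow_add_one hx0.ne', neg_add, neg_add_cancel_right]
    have hnorm : ‖Complex.I * x * ∫ ω in Ioi |x|⁻¹, halfLineIntegrand β f x ω‖ =
        |x| * ‖∫ ω in Ioi |x|⁻¹, halfLineIntegrand β f x ω‖ := by simp
    refine le_of_mul_le_mul_left ?_ hx0
    rw [← hnorm, I_mul_mul_integral_halfLineIntegrand β f x (inv_pos.2 hx0), mul_left_comm, ← hpow,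
      add_mul]
    refine (norm_sub_le _ _).trans (add_le_add ?_ ?_)
    · have h := hboundary x _ (inv_pos.2 hx0)
      rwa [Real.inv_rpow hx0.le, ← Real.rpow_neg hx0.le, ← norm_neg] at h
    · simpa using htail x hx

theorem exists_norm_halfLine_le {β : ℂ} (hβ : -1 < β.re) (f : SchwartzMap ℝ ℂ) :
    ∃ C, 0 ≤ C ∧ ∀ x : ℝ, x ≠ 0 →
      ‖∫ ω in Ioi 0, halfLineIntegrand β f x ω‖ ≤ C * |x| ^ (-(β.re + 1)) := by
  obtain ⟨C₁, hC₁, hhead⟩ := exists_norm_halfLineIntegrand_le β f le_rfl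
  obtain ⟨C₂, hC₂, htail⟩ := exists_norm_halfLine_tail_le β f
  refine ⟨C₁ / (β.re + 1) + C₂, add_nonneg (div_nonneg hC₁ (by linarith)) hC₂, fun x hx => ?_⟩
  have hδ : 0 < |x|⁻¹ := inv_pos.2 (abs_pos.2 hx)
  have hint := integrableOn_halfLineIntegrand β f x hβ
  rw [← Ioc_union_Ioi_eq_Ioi hδ.le, setIntegral_union (Ioc_disjoint_Ioi le_rfl) measurableSet_Ioi
    (hint.mono_set Ioc_subset_Ioi_self) (hint.mono_set (Ioi_subset_Ioi hδ.le)), add_mul]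
  refine (norm_add_le _ _).trans (add_le_add ?_ (htail x hx))
  calc ‖∫ ω in Ioc 0 |x|⁻¹, halfLineIntegrand β f x ω‖ ≤ ∫ ω in Ioc 0 |x|⁻¹, C₁ * ω ^ β.re :=
      norm_integral_le_of_norm_le ((intervalIntegral.intervalIntegrable_rpow' hβ).1.const_mul C₁)
        ((ae_restrict_iff' measurableSet_Ioc).2 (ae_of_all _ fun ω hω => hhead x ω hω.1))
    _ = C₁ / (β.re + 1) * |x| ^ (-(β.re + 1)) := by
      rw [integral_const_mul,
        ← intervalIntegral.integral_of_le (f := fun ω : ℝ => ω ^ β.re) hδ.le,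
        integral_rpow (Or.inl hβ), Real.zero_rpow (by linarith), sub_zero,
        Real.inv_rpow (abs_nonneg x), ← Real.rpow_neg (abs_nonneg x), mul_div_left_comm, mul_comm]

/-! ### The homogeneous profile -/

/-- The inverse Fourier transform of `D(ω) h(ω)`, for the homogeneous multiplier
`h = p ω₊^β + q ω₋^β`. -/
def homProfile (p q β : ℂ) (D : SchwartzMap ℝ ℂ) : ℝ → ℂ :=
  fourierInv fun ω => D ω * homMultiplier p q β ω

theorem integral_eq_Ioi_add_comp_neg {f : ℝ → ℂ} (hf : Integrable f) :
    ∫ x, f x = (∫ x in Ioi 0, f x) + ∫ x in Ioi 0, f (-x) := by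
  rw [integral_comp_neg_Ioi, neg_zero, add_comm]
  exact (intervalIntegral.integral_Iic_add_Ioi hf.integrableOn hf.integrableOn).symm

section HomProfile

variable (p q : ℂ) {β : ℂ} (hβ : -1 < β.re) (D : SchwartzMap ℝ ℂ)

include hβ

theorem integrable_mul_homMultiplier : Integrable fun ω : ℝ => D ω * homMultiplier p q β ω := by
  refine ((integrable_abs_rpow_mul_schwartz hβ D).const_mul (‖p‖ + ‖q‖)).mono'
    (D.continuous.aestronglyMeasurable.mul (measurable_homMultiplier p q β).aestronglyMeasurable)
    (ae_of_all _ fun ω => ?_)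
  rw [norm_mul, mul_comm, ← mul_assoc]
  gcongr
  exact norm_homMultiplier_le p q β ω

theorem continuous_homProfile : Continuous (homProfile p q β D) :=
  continuous_fourierInv (integrable_mul_homMultiplier p q hβ D)

theorem homProfile_eq_integral_halfLine (x : ℝ) :
    homProfile p q β D x = 1 / (2 * (Real.pi : ℂ)) *
      (p * (∫ ω in Ioi 0, halfLineIntegrand β D x ω) +
        q * ∫ ω in Ioi 0, halfLineIntegrand β (schwartzDilate (-1) D) (-x) ω) := by
  rw [homProfile, fourierInv,
    integral_eq_Ioi_add_comp_neg (integrable_mul_exp (integrable_mul_homMultiplier p q hβ D) x),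
    ← integral_const_mul, ← integral_const_mul]
  congr 2 <;> refine setIntegral_congr_fun measurableSet_Ioi fun ω hω => ?_
  · simp only [homMultiplier_of_pos p q β hω, halfLineIntegrand]
    ring
  · simp only [homMultiplier_neg_of_pos p q β hω, halfLineIntegrand, schwartzDilate_apply,
      Units.val_neg, Units.val_one, neg_one_mul]
    push_cast
    ring_nf

theorem exists_norm_homProfile_le :
    ∃ C, 0 ≤ C ∧ ∀ x : ℝ, ‖homProfile p q β D x‖ ≤ C * (1 + |x|) ^ (-(β.re + 1)) := by
  obtain ⟨C₁, -, hpos⟩ := exists_norm_halfLine_le hβ D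
  obtain ⟨C₂, -, hneg⟩ := exists_norm_halfLine_le hβ (schwartzDilate (-1) D)
  refine exists_norm_le_one_add_rpow (C := ‖p‖ * C₁ + ‖q‖ * C₂)
    (norm_fourierInv_le fun ω => D ω * homMultiplier p q β ω) (by linarith) fun x hx => ?_
  rw [homProfile_eq_integral_halfLine p q hβ, norm_mul, add_mul, mul_assoc, mul_assoc]
  refine (mul_le_of_le_one_left (norm_nonneg _) norm_one_div_two_pi_le_one).trans
    ((norm_add_le _ _).trans ?_)
  rw [norm_mul, norm_mul]
  gcongr
  · exact hpos x hx
  · simpa using hneg (-x) (neg_ne_zero.2 hx)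

end HomProfile

theorem fourierInv_dilate_mul_homMultiplier (p q β : ℂ) (D : ℝ → ℂ) {t : ℝ} (ht : 0 < t) (x : ℝ) :
    fourierInv (fun ω => D (t * ω) * homMultiplier p q β ω) x =
      (t : ℂ) ^ (-(β + 1)) * fourierInv (fun ω => D ω * homMultiplier p q β ω) (x / t) := by
  have ht0 : (t : ℂ) ≠ 0 := Complex.ofReal_ne_zero.2 ht.ne'
  have hscale (ω : ℝ) : D (t * ω) * homMultiplier p q β ω =
      (t : ℂ) ^ (-β) * (D (t * ω) * homMultiplier p q β (t * ω)) := by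
    rw [homMultiplier_mul_left p q β ht, mul_left_comm, ← mul_assoc (_ ^ (-β)),
      ← Complex.cpow_add _ _ ht0, neg_add_cancel, Complex.cpow_zero, one_mul]
  simp only [hscale, fourierInv_const_mul]
  rw [fourierInv_comp_mul_left (fun ω => D ω * homMultiplier p q β ω) ht, ← mul_assoc, neg_add,
    Complex.cpow_add _ _ ht0, Complex.cpow_neg_one]

/-! ### Taylor remainders -/

/-- The weight `(1 - t)^n / n!` of the integral form of the Taylor remainder. -/
def taylorWeight (n : ℕ) (t : ℝ) : ℝ :=
  (1 - t) ^ n / n.factorial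

@[fun_prop]
theorem continuous_taylorWeight (n : ℕ) : Continuous (taylorWeight n) := by
  unfold taylorWeight
  fun_prop

theorem norm_taylorWeight_smul_le (n : ℕ) {t : ℝ} (ht : t ∈ Ioc (0 : ℝ) 1) (z : ℂ) :
    ‖taylorWeight n t • z‖ ≤ ‖z‖ := by
  have hnonneg : 0 ≤ 1 - t := by linarith [ht.2]
  rw [norm_smul, taylorWeight, Real.norm_of_nonneg (by positivity)]
  refine mul_le_of_le_one_left (norm_nonneg z) (div_le_one_of_le₀ ?_ (by positivity))
  exact (pow_le_one₀ hnonneg (by linarith [ht.1])).trans (by exact_mod_cast n.factorial_pos)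

theorem hasDerivAt_taylorWeight_succ (n : ℕ) (t : ℝ) :
    HasDerivAt (taylorWeight (n + 1)) (-taylorWeight n t) t := by
  convert! (((hasDerivAt_id t).const_sub 1).pow (n + 1)).div_const ((n + 1).factorial : ℝ) using 1
  rw [taylorWeight, Nat.factorial_succ]
  push_cast
  simp only [id_eq]
  field_simp

/-- The weighted average of a function on `[0, 1]` in which Taylor remainders are expressed. -/
def taylorAverage (n : ℕ) (f : ℝ → ℂ) : ℂ :=
  ∫ t in (0 : ℝ)..1, taylorWeight n t • f t

theorem taylorAverage_const_mul (n : ℕ) (c : ℂ) (f : ℝ → ℂ) :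
    taylorAverage n (fun t => c * f t) = c * taylorAverage n f := by
  simp only [taylorAverage, ← mul_smul_comm, intervalIntegral.integral_const_mul]

theorem taylorAverage_mul_const (n : ℕ) (f : ℝ → ℂ) (c : ℂ) :
    taylorAverage n (fun t => f t * c) = taylorAverage n f * c := by
  simp only [mul_comm _ c, taylorAverage_const_mul]

theorem taylorAverage_congr (n : ℕ) {f g : ℝ → ℂ} (h : ∀ t ∈ Ioc (0 : ℝ) 1, f t = g t) :
    taylorAverage n f = taylorAverage n g := by
  refine intervalIntegral.integral_congr_ae (ae_of_all _ fun t ht => ?_)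
  rw [uIoc_of_le zero_le_one] at ht
  simp only [h t ht]

theorem norm_taylorAverage_le (n : ℕ) {f : ℝ → ℂ} {b : ℝ → ℝ}
    (hf : ∀ t ∈ Ioc (0 : ℝ) 1, ‖f t‖ ≤ b t) (hb : IntervalIntegrable b volume 0 1) :
    ‖taylorAverage n f‖ ≤ ∫ t in (0 : ℝ)..1, b t :=
  intervalIntegral.norm_integral_le_of_norm_le zero_le_one
    (ae_of_all _ fun t ht => (norm_taylorWeight_smul_le n ht _).trans (hf t ht)) hb

theorem taylorAverage_zero_deriv {f f' : ℝ → ℂ} (hf : ∀ t, HasDerivAt f (f' t) t)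
    (hf' : Continuous f') : taylorAverage 0 f' = f 1 - f 0 := by
  simpa [taylorAverage, taylorWeight] using
    intervalIntegral.integral_eq_sub_of_hasDerivAt (fun t _ => hf t) (hf'.intervalIntegrable 0 1)

theorem taylorAverage_succ_deriv (n : ℕ) {f f' : ℝ → ℂ} (hf : ∀ t, HasDerivAt f (f' t) t)
    (hf' : Continuous f') :
    taylorAverage (n + 1) f' = taylorAverage n f - f 0 / (n + 1).factorial := by
  have hparts := intervalIntegral.integral_smul_deriv_eq_deriv_smul (a := 0) (b := 1)
    (fun t _ => hasDerivAt_taylorWeight_succ n t) (fun t _ => hf t)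
    ((continuous_taylorWeight n).neg.intervalIntegrable 0 1) (hf'.intervalIntegrable 0 1)
  have hone : taylorWeight (n + 1) 1 = 0 := by simp [taylorWeight]
  have hzero : taylorWeight (n + 1) 0 • f 0 = f 0 / (n + 1).factorial := by
    simp [taylorWeight, div_eq_inv_mul]
  simp only [hone, hzero, zero_smul, neg_smul, intervalIntegral.integral_neg] at hparts
  rw [taylorAverage, hparts, taylorAverage]
  ring

theorem integrable_taylorWeight_smul_prod (n : ℕ) {K : ℝ → ℝ → ℂ}
    (hK : Integrable (Function.uncurry K) ((volume.restrict (Ioc 0 1)).prod volume)) :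
    Integrable (Function.uncurry fun t x => taylorWeight n t • K t x)
      ((volume.restrict (Ioc 0 1)).prod volume) := by
  refine hK.mono (AEStronglyMeasurable.smul (f := fun z : ℝ × ℝ => taylorWeight n z.1)
    (by fun_prop) hK.1) ?_
  filter_upwards [Measure.quasiMeasurePreserving_fst.ae (ae_restrict_mem measurableSet_Ioc)]
    with z hz using norm_taylorWeight_smul_le n hz _

theorem integrable_taylorAverage (n : ℕ) {K : ℝ → ℝ → ℂ}
    (hK : Integrable (Function.uncurry K) ((volume.restrict (Ioc 0 1)).prod volume)) :
    Integrable fun x => taylorAverage n fun t => K t x := by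
  simp only [taylorAverage, intervalIntegral.integral_of_le zero_le_one]
  exact (integrable_taylorWeight_smul_prod n hK).integral_prod_right

theorem integral_taylorAverage (n : ℕ) {K : ℝ → ℝ → ℂ}
    (hK : Integrable (Function.uncurry K) ((volume.restrict (Ioc 0 1)).prod volume)) :
    ∫ x, taylorAverage n (fun t => K t x) = taylorAverage n fun t => ∫ x, K t x := by
  simp only [taylorAverage, intervalIntegral.integral_of_le zero_le_one]
  rw [← integral_integral_swap (integrable_taylorWeight_smul_prod n hK)]
  simp only [integral_smul]

/-- The weighted mean `∫₀¹ (1 - t)^n / n! G(tω) dt` of the dilates of `G`. -/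
def taylorMean (n : ℕ) (G : ℝ → ℂ) (ω : ℝ) : ℂ :=
  taylorAverage n fun t => G (t * ω)

section TaylorMean

variable {G G' : ℝ → ℂ}

theorem norm_taylorMean_le (n : ℕ) {M : ℝ} (hM : ∀ ω, ‖G ω‖ ≤ M) (ω : ℝ) :
    ‖taylorMean n G ω‖ ≤ M := by
  simpa [taylorMean] using norm_taylorAverage_le n (f := fun t => G (t * ω)) (b := fun _ => M)
    (fun t _ => hM _) intervalIntegrable_const

theorem continuous_taylorMean (n : ℕ) (hG : Continuous G) : Continuous (taylorMean n G) := by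
  unfold taylorMean taylorAverage
  fun_prop

theorem integral_taylorMean_mul (n : ℕ) (hG : Continuous G) {M : ℝ} (hM : ∀ ω, ‖G ω‖ ≤ M)
    {w : ℝ → ℂ} (hw : Integrable w) :
    ∫ ω, taylorMean n G ω * w ω = taylorAverage n fun t => ∫ ω, G (t * ω) * w ω := by
  simp only [taylorMean, ← taylorAverage_mul_const]
  refine integral_taylorAverage n (K := fun t ω => G (t * ω) * w ω) ?_
  exact (hw.comp_snd (volume.restrict (Ioc 0 1))).bdd_mul (f := fun z : ℝ × ℝ => G (z.1 * z.2))
    (c := M) (by fun_prop) (ae_of_all _ fun z => hM _)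

theorem hasDerivAt_comp_mul_const (hG : ∀ ω, HasDerivAt G (G' ω) ω) (ω t : ℝ) :
    HasDerivAt (fun t : ℝ => G (t * ω)) (ω * G' (t * ω)) t := by
  simpa only [Function.comp_def, Complex.real_smul] using
    (hG (t * ω)).scomp t (hasDerivAt_mul_const ω)

theorem mul_taylorMean_zero (hG : ∀ ω, HasDerivAt G (G' ω) ω) (hG' : Continuous G') (ω : ℝ) :
    ω * taylorMean 0 G' ω = G ω - G 0 := by
  rw [taylorMean, ← taylorAverage_const_mul,
    taylorAverage_zero_deriv (hasDerivAt_comp_mul_const hG ω) (by fun_prop), one_mul, zero_mul]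

theorem mul_taylorMean_succ (n : ℕ) (hG : ∀ ω, HasDerivAt G (G' ω) ω) (hG' : Continuous G')
    (ω : ℝ) : ω * taylorMean (n + 1) G' ω = taylorMean n G ω - G 0 / (n + 1).factorial := by
  rw [taylorMean, ← taylorAverage_const_mul,
    taylorAverage_succ_deriv n (hasDerivAt_comp_mul_const hG ω) (by fun_prop), zero_mul, taylorMean]

end TaylorMean

/-- The `k`-th derivative as an operator on Schwartz functions. -/
def schwartzDeriv (k : ℕ) (f : SchwartzMap ℝ ℂ) : SchwartzMap ℝ ℂ :=
  (SchwartzMap.derivCLM ℂ ℂ)^[k] f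

theorem schwartzDeriv_succ (k : ℕ) (f : SchwartzMap ℝ ℂ) :
    schwartzDeriv (k + 1) f = SchwartzMap.derivCLM ℂ ℂ (schwartzDeriv k f) :=
  Function.iterate_succ_apply' _ _ _

theorem coe_schwartzDeriv (k : ℕ) (f : SchwartzMap ℝ ℂ) :
    ⇑(schwartzDeriv k f) = iteratedDeriv k f := by
  induction k with
  | zero => simp [schwartzDeriv]
  | succ k ih =>
    ext x
    rw [iteratedDeriv_succ, ← ih, schwartzDeriv_succ, SchwartzMap.derivCLM_apply]

theorem hasDerivAt_derivCLM (f : SchwartzMap ℝ ℂ) (x : ℝ) :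
    HasDerivAt f (SchwartzMap.derivCLM ℂ ℂ f x) x :=
  f.differentiableAt.hasDerivAt

theorem sub_taylorSum_eq (n : ℕ) (f : SchwartzMap ℝ ℂ) (ω : ℝ) :
    f ω - ∑ j ∈ Finset.range (n + 1), iteratedDeriv j f 0 / (j.factorial : ℂ) * (ω : ℂ) ^ j =
      (ω : ℂ) ^ (n + 1) * taylorMean n (schwartzDeriv (n + 1) f) ω := by
  have hderiv (k : ℕ) (x : ℝ) :
      HasDerivAt (schwartzDeriv k f) (schwartzDeriv (k + 1) f x) x := by
    rw [schwartzDeriv_succ]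
    exact hasDerivAt_derivCLM _ x
  induction n with
  | zero =>
    simpa [schwartzDeriv] using
      (mul_taylorMean_zero (hderiv 0) (schwartzDeriv 1 f).continuous ω).symm
  | succ n ih =>
    rw [Finset.sum_range_succ, ← sub_sub, ih, pow_succ _ (n + 1), mul_assoc _ (ω : ℂ),
      mul_taylorMean_succ n (hderiv (n + 1)) (schwartzDeriv (n + 2) f).continuous,
      coe_schwartzDeriv]
    ring

/-! ### Weighted means of dilates -/

/-- The weighted mean `∫₀¹ (1 - t)^n / n! t^{-(β+1)} η(x/t) dt` of the dilates of `η`. -/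
def dilationMean (n : ℕ) (β : ℂ) (η : ℝ → ℂ) (x : ℝ) : ℂ :=
  taylorAverage n fun t => (t : ℂ) ^ (-(β + 1)) * η (x / t)

section DilationMean

variable {β : ℂ} {η : ℝ → ℂ} {C : ℝ}

theorem norm_dilate_le (hη : ∀ x : ℝ, ‖η x‖ ≤ C * (1 + |x|) ^ (-(β.re + 1))) {t : ℝ} (ht : 0 < t)
    (x : ℝ) : ‖(t : ℂ) ^ (-(β + 1)) * η (x / t)‖ ≤ C * (t + |x|) ^ (-(β.re + 1)) := by
  have hre : (-(β + 1)).re = -(β.re + 1) := by simp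
  have hsum : t * (1 + |x / t|) = t + |x| := by
    rw [abs_div, abs_of_pos ht]
    field_simp
  rw [norm_mul, Complex.norm_cpow_eq_rpow_re_of_pos ht, hre, ← hsum,
    Real.mul_rpow ht.le (by positivity), mul_left_comm]
  gcongr
  exact hη _

theorem norm_dilationMean_le (n : ℕ) (hη : ∀ x : ℝ, ‖η x‖ ≤ C * (1 + |x|) ^ (-(β.re + 1))) {x : ℝ}
    (hx : x ≠ 0) : ‖dilationMean n β η x‖ ≤ C * kernelIntegral (β.re + 1) |x| := by
  rw [kernelIntegral, ← intervalIntegral.integral_const_mul]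
  exact norm_taylorAverage_le n (fun t ht => norm_dilate_le hη ht.1 x)
    ((intervalIntegrable_add_rpow (abs_pos.2 hx) _).const_mul C)

theorem measurable_dilate (β : ℂ) (hη : Continuous η) :
    Measurable fun z : ℝ × ℝ => (z.1 : ℂ) ^ (-(β + 1)) * η (z.2 / z.1) := by
  have := hη.measurable.comp (measurable_snd.div (measurable_fst (α := ℝ) (β := ℝ)))
  fun_prop

theorem continuousOn_dilationMean (n : ℕ) (hβ : -1 < β.re) (hη : Continuous η)
    (hC : ∀ x : ℝ, ‖η x‖ ≤ C * (1 + |x|) ^ (-(β.re + 1))) :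
    ContinuousOn (dilationMean n β η) {0}ᶜ := by
  intro x₀ hx₀
  have hC0 : 0 ≤ C := by simpa using (norm_nonneg _).trans (hC 0)
  have hx₀' : 0 < |x₀| := abs_pos.2 hx₀
  have hnear : ∀ᶠ x : ℝ in 𝓝 x₀, |x₀| / 2 < |x| :=
    continuous_abs.continuousAt.eventually (lt_mem_nhds (half_lt_self hx₀'))
  refine (intervalIntegral.continuousAt_of_dominated_interval
    (bound := fun _ => C * (|x₀| / 2) ^ (-(β.re + 1))) (Eventually.of_forall fun x => ?_) ?_
    intervalIntegrable_const (ae_of_all _ fun t _ => by fun_prop)).continuousWithinAt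
  · exact ((continuous_taylorWeight n).measurable.smul ((measurable_dilate β hη).comp
      (measurable_id.prodMk measurable_const))).aestronglyMeasurable
  · filter_upwards [hnear] with x hx
    refine ae_of_all _ fun t ht => ?_
    rw [uIoc_of_le zero_le_one] at ht
    refine (norm_taylorWeight_smul_le n ht _).trans ((norm_dilate_le hC ht.1 x).trans ?_)
    gcongr 1
    exact Real.rpow_le_rpow_of_nonpos (by positivity) (by linarith [ht.1]) (by linarith)

theorem integrable_dilate_mul (hη : Continuous η)
    (hC : ∀ x : ℝ, ‖η x‖ ≤ C * (1 + |x|) ^ (-(β.re + 1))) {ψ : ℝ → ℂ} (hψ : Continuous ψ)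
    {A B : ℝ → ℝ} (hA : IntegrableOn A (Ioc 0 1)) (hB : Integrable B)
    (hAB : ∀ t ∈ Ioc (0 : ℝ) 1, ∀ x : ℝ, x ≠ 0 →
      (t + |x|) ^ (-(β.re + 1)) * ‖ψ x‖ ≤ A t * B x) :
    Integrable (Function.uncurry fun t x : ℝ => (t : ℂ) ^ (-(β + 1)) * η (x / t) * ψ x)
      ((volume.restrict (Ioc 0 1)).prod volume) := by
  have hC0 : 0 ≤ C := by simpa using (norm_nonneg _).trans (hC 0)
  refine ((hA.mul_prod hB).const_mul C).mono' ((measurable_dilate β hη).mul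
    (hψ.measurable.comp measurable_snd)).aestronglyMeasurable ?_
  filter_upwards [Measure.quasiMeasurePreserving_fst.ae (ae_restrict_mem measurableSet_Ioc),
    Measure.quasiMeasurePreserving_snd.ae (Measure.ae_ne volume 0)] with ⟨t, x⟩ ht hx
  calc ‖(t : ℂ) ^ (-(β + 1)) * η (x / t) * ψ x‖
      ≤ C * (t + |x|) ^ (-(β.re + 1)) * ‖ψ x‖ := by
        rw [norm_mul]
        gcongr
        exact norm_dilate_le hC ht.1 x
    _ ≤ C * (A t * B x) := by
        rw [mul_assoc]
        exact mul_le_mul_of_nonneg_left (hAB t ht x hx) hC0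

end DilationMean

/-! ### The remainder symbol and its inverse Fourier transform -/

/-- The product of a homogeneous function and a weighted mean of dilates of `D`. When `D` is the
`(n + 1)`-st derivative of `φ̂`, this is the symbol of the adjoint integrator. -/
def remainderSymbol (n : ℕ) (p q β : ℂ) (D : SchwartzMap ℝ ℂ) (ω : ℝ) : ℂ :=
  taylorMean n D ω * homMultiplier p q β ω

/-- The function which is, away from the origin, the inverse Fourier transform of
`remainderSymbol n p q β D`. -/
def remainderTransform (n : ℕ) (p q β : ℂ) (D : SchwartzMap ℝ ℂ) : ℝ → ℂ :=
  dilationMean n β (homProfile p q β D)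

section Remainder

theorem exists_norm_schwartz_le_const (D : SchwartzMap ℝ ℂ) : ∃ M, 0 ≤ M ∧ ∀ ω, ‖D ω‖ ≤ M := by
  simpa using exists_norm_schwartz_le 0 D

variable (n : ℕ) (p q : ℂ) {β : ℂ} (D : SchwartzMap ℝ ℂ)

theorem exists_norm_remainderSymbol_le (β : ℂ) :
    ∃ C, 0 ≤ C ∧ ∀ ω : ℝ, ‖remainderSymbol n p q β D ω‖ ≤ C * |ω| ^ β.re := by
  obtain ⟨M, hM0, hM⟩ := exists_norm_schwartz_le_const D
  refine ⟨M * (‖p‖ + ‖q‖), by positivity, fun ω => ?_⟩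
  rw [remainderSymbol, norm_mul, mul_assoc]
  gcongr
  exacts [norm_taylorMean_le n hM ω, norm_homMultiplier_le p q β ω]

theorem measurable_remainderSymbol (β : ℂ) : Measurable (remainderSymbol n p q β D) :=
  (continuous_taylorMean n D.continuous).measurable.mul (measurable_homMultiplier p q β)

variable (hβ : -1 < β.re)

include hβ

theorem integral_remainderSymbol_mul_fourierInv (ψ : SchwartzMap ℝ ℂ) :
    ∫ ω, remainderSymbol n p q β D ω * fourierInv ψ ω = taylorAverage n fun t =>
      ∫ x, (t : ℂ) ^ (-(β + 1)) * homProfile p q β D (x / t) * ψ x := by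
  obtain ⟨M, -, hM⟩ := exists_norm_schwartz_le_const D
  have hθ : Integrable fun ω => homMultiplier p q β ω * fourierInv ψ ω := by
    simpa only [mul_comm, coe_schwartzFourierInv] using
      integrable_mul_homMultiplier p q hβ (schwartzFourierInv ψ)
  simp only [remainderSymbol, mul_assoc]
  rw [integral_taylorMean_mul n D.continuous hM hθ]
  refine taylorAverage_congr n fun t ht => ?_
  have hdilate : Integrable fun ω => D (t * ω) * homMultiplier p q β ω :=
    integrable_mul_homMultiplier p q hβ (schwartzDilate (Units.mk0 t ht.1.ne') D)
  simp only [← mul_assoc]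
  rw [integral_mul_fourierInv hdilate ψ.integrable]
  simp only [fourierInv_dilate_mul_homMultiplier p q β D ht.1, homProfile]

theorem representedAt_of_kernel_le {A B : ℝ → ℝ} (hA : IntegrableOn A (Ioc 0 1))
    (hB : Integrable B) {ψ : SchwartzMap ℝ ℂ} (hAB : ∀ t ∈ Ioc (0 : ℝ) 1, ∀ x : ℝ, x ≠ 0 →
      (t + |x|) ^ (-(β.re + 1)) * ‖ψ x‖ ≤ A t * B x) :
    RepresentedAt (fun ψ => ∫ ω, remainderSymbol n p q β D ω * fourierInv ψ ω)
      (remainderTransform n p q β D) ψ := by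
  obtain ⟨C, -, hC⟩ := exists_norm_homProfile_le p q hβ D
  have hint := integrable_dilate_mul (continuous_homProfile p q hβ D) hC ψ.continuous hA hB hAB
  have heq (x : ℝ) : remainderTransform n p q β D x * ψ x =
      taylorAverage n fun t => (t : ℂ) ^ (-(β + 1)) * homProfile p q β D (x / t) * ψ x :=
    (taylorAverage_mul_const n _ _).symm
  simp only [RepresentedAt, heq]
  refine ⟨integrable_taylorAverage n hint, ?_⟩
  rw [integral_taylorAverage n hint, integral_remainderSymbol_mul_fourierInv n p q D hβ]

theorem representedAt_of_zero_notMem_tsupport {ψ : SchwartzMap ℝ ℂ} (hψ : (0 : ℝ) ∉ tsupport ψ) :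
    RepresentedAt (fun ψ => ∫ ω, remainderSymbol n p q β D ω * fourierInv ψ ω)
      (remainderTransform n p q β D) ψ := by
  obtain ⟨δ, hδ, hzero⟩ := Metric.eventually_nhds_iff.1 (notMem_tsupport_iff_eventuallyEq.1 hψ)
  refine representedAt_of_kernel_le n p q D hβ (A := fun _ => δ ^ (-(β.re + 1)))
    (B := fun x => ‖ψ x‖) (integrable_const _) ψ.integrable.norm fun t ht x _ => ?_
  rcases lt_or_ge |x| δ with hx | hx
  · have : ψ x = 0 := hzero (by simpa using hx)
    simp [this]
  · gcongr 1
    exact Real.rpow_le_rpow_of_nonpos hδ (by linarith [ht.1]) (by linarith)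

theorem representedAt_of_lt_one (hβ₁ : β.re < 1) (ψ : SchwartzMap ℝ ℂ) :
    RepresentedAt (fun ψ => ∫ ω, remainderSymbol n p q β D ω * fourierInv ψ ω)
      (remainderTransform n p q β D) ψ := by
  set r : ℝ := (β.re + 1) / 2 with hr
  refine representedAt_of_kernel_le n p q D hβ (A := fun t => t ^ (-r))
    (B := fun x => |x| ^ (-r) * ‖ψ x‖)
    (intervalIntegral.intervalIntegrable_rpow' (a := 0) (b := 1) (by linarith)).1
    (integrable_abs_rpow_mul_schwartz (by linarith) ψ) fun t ht x hx => ?_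
  have hx' : 0 < |x| := abs_pos.2 hx
  have hone : (1 + |x|) ^ (-r) ≤ 1 :=
    Real.rpow_le_one_of_one_le_of_nonpos (by linarith) (by linarith)
  rw [← mul_assoc, ← add_halves (β.re + 1), ← hr]
  gcongr
  refine (add_rpow_neg_le ht hx' (by linarith) (by linarith)).trans ?_
  gcongr
  · exact Real.rpow_nonneg ht.1.le _
  · exact mul_le_of_le_one_right (by positivity) hone

end Remainder

theorem inv_one_add_sq_pow_le (N : ℕ) (ω : ℝ) :
    ((1 + ω ^ 2) ^ N)⁻¹ ≤ 2 ^ N * (1 + |ω|) ^ (-((2 * N : ℕ) : ℝ)) := by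
  have hsq : (1 + |ω|) ^ 2 ≤ 2 * (1 + ω ^ 2) := by
    nlinarith [sq_nonneg (1 - |ω|), sq_abs ω]
  rw [Real.rpow_neg (by positivity), Real.rpow_natCast, pow_mul, ← div_eq_mul_inv,
    inv_le_comm₀ (by positivity) (by positivity), inv_div, div_le_iff₀ (by positivity), ← mul_pow,
    mul_comm (1 + ω ^ 2)]
  gcongr

theorem exists_temperedDistribution_of_norm_le_rpow {m : ℝ → ℂ} (hm : Measurable m) {C s : ℝ}
    (hs : -1 < s) (hC : ∀ ω, ‖m ω‖ ≤ C * |ω| ^ s) :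
    ∃ T : TemperedDistribution ℝ ℂ, ∀ θ : SchwartzMap ℝ ℂ, T θ = ∫ ω, m ω * θ ω := by
  obtain ⟨N, hN⟩ := exists_nat_gt (s + 1)
  have hweight (ω : ℝ) : (1 + (ω : ℂ) ^ 2) ^ N ≠ 0 := by
    exact_mod_cast (by positivity : (1 + ω ^ 2) ^ N ≠ 0)
  have hint : Integrable fun ω : ℝ => ((1 + (ω : ℂ) ^ 2) ^ N)⁻¹ * m ω := by
    refine ((integrable_abs_rpow_mul_one_add_rpow hs (m := (2 * N : ℕ))
      (by push_cast; linarith)).const_mul (2 ^ N * C)).mono'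
      (Measurable.aestronglyMeasurable (by fun_prop)) (ae_of_all _ fun ω => ?_)
    have hnorm : ‖((1 + (ω : ℂ) ^ 2) ^ N)⁻¹‖ = ((1 + ω ^ 2) ^ N)⁻¹ := by
      rw [norm_inv, ← Real.norm_of_nonneg (by positivity : 0 ≤ (1 + ω ^ 2) ^ N),
        ← Complex.norm_real]
      push_cast
      rfl
    rw [norm_mul, hnorm]
    refine (mul_le_mul (inv_one_add_sq_pow_le N ω) (hC ω) (norm_nonneg _)
      (by positivity)).trans_eq (by ring)
  have hmem := memLp_one_iff_integrable.2 hint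
  refine ⟨TemperedDistribution.smulLeftCLM ℂ (fun ω : ℝ => (1 + (ω : ℂ) ^ 2) ^ N)
    (Lp.toTemperedDistribution (hmem.toLp _)), fun θ => ?_⟩
  rw [TemperedDistribution.smulLeftCLM_apply_apply, Lp.toTemperedDistribution_apply]
  refine integral_congr_ae ?_
  filter_upwards [hmem.coeFn_toLp] with ω hω
  rw [hω, SchwartzMap.smulLeftCLM_apply_apply (by fun_prop)]
  have := hweight ω
  simp only [smul_eq_mul]
  field_simp

theorem exists_temperedDistribution_integral_remainderSymbol (n : ℕ) (p q : ℂ) {β : ℂ}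
    (hβ : -1 < β.re) (D : SchwartzMap ℝ ℂ) :
    ∃ T : TemperedDistribution ℝ ℂ, ∀ ψ : SchwartzMap ℝ ℂ,
      T ψ = ∫ ω, remainderSymbol n p q β D ω * fourierInv ψ ω := by
  obtain ⟨C, -, hC⟩ := exists_norm_remainderSymbol_le n p q D β
  obtain ⟨T, hT⟩ := exists_temperedDistribution_of_norm_le_rpow
    (measurable_remainderSymbol n p q D β) hβ hC
  exact ⟨PointwiseConvergenceCLM.precomp ℂ schwartzFourierInv T,
    fun ψ => (hT (schwartzFourierInv ψ)).trans (by rw [coe_schwartzFourierInv])⟩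

theorem integrable_remainderSymbol_mul (n : ℕ) (p q : ℂ) {β : ℂ} (hβ : -1 < β.re)
    (D θ : SchwartzMap ℝ ℂ) : Integrable fun ω => remainderSymbol n p q β D ω * θ ω := by
  obtain ⟨C, -, hC⟩ := exists_norm_remainderSymbol_le n p q D β
  refine ((integrable_abs_rpow_mul_schwartz hβ θ).const_mul C).mono'
    ((measurable_remainderSymbol n p q D β).mul θ.continuous.measurable).aestronglyMeasurable
    (ae_of_all _ fun ω => ?_)
  rw [norm_mul, ← mul_assoc]
  gcongr
  exact hC ω

theorem adjSymbol_eq_remainderSymbol (a b γ : ℂ) (n : ℕ) (φ : SchwartzMap ℝ ℂ) :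
    adjSymbol a b γ (n + 1) φ = remainderSymbol n b⁻¹ ((-1) ^ (n + 1) / a) ((n + 1 : ℕ) - γ)
      (schwartzDeriv (n + 1) (schwartzFourier φ)) := by
  ext ω
  rw [adjSymbol, ← coe_schwartzFourier, sub_taylorSum_eq, mul_div_right_comm,
    pow_div_homMultiplier_neg, remainderSymbol, mul_comm]

/-! ### Size of the inverse Fourier transform -/

theorem boundedNearZero_of_le {f : ℝ → ℝ} {C : ℝ} (hf : ∀ x, x ≠ 0 → |f x| ≤ C) :
    BoundedNearZero f :=
  ⟨C, eventually_mem_nhdsWithin.mono hf⟩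

section Size

variable (n : ℕ) (p q : ℂ) {β : ℂ} (hβ : -1 < β.re) (D : SchwartzMap ℝ ℂ)

include hβ

theorem continuousOn_remainderTransform : ContinuousOn (remainderTransform n p q β D) {0}ᶜ := by
  obtain ⟨C, -, hC⟩ := exists_norm_homProfile_le p q hβ D
  exact continuousOn_dilationMean n hβ (continuous_homProfile p q hβ D) hC

theorem exists_norm_remainderTransform_le :
    ∃ C, 0 < C ∧ ∀ x : ℝ, x ≠ 0 →
      ‖remainderTransform n p q β D x‖ ≤ C * kernelIntegral (β.re + 1) |x| := by
  obtain ⟨C, hC0, hC⟩ := exists_norm_homProfile_le p q hβ D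
  exact ⟨C + 1, by positivity, fun x hx => norm_dilationMean_le n
    (fun y => (hC y).trans (by gcongr; exact le_add_of_nonneg_right zero_le_one)) hx⟩

theorem exists_norm_remainderTransform_le_div :
    ∃ c, 0 < c ∧ ∀ x : ℝ, x ≠ 0 →
      ‖remainderTransform n p q β D x‖ ≤ c / |x| ^ (β.re + 1) := by
  obtain ⟨C, hC0, hC⟩ := exists_norm_remainderTransform_le n p q hβ D
  refine ⟨C, hC0, fun x hx => (hC x hx).trans ?_⟩
  rw [div_eq_mul_inv, ← Real.rpow_neg (abs_nonneg x)]
  gcongr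
  exact kernelIntegral_le_rpow (by linarith) (abs_pos.2 hx)

theorem memLp_remainderTransform {r : ℝ} (hr : 1 / (β.re + 1) < r) (hr' : β.re * r < 1) :
    MemLp (remainderTransform n p q β D) (ENNReal.ofReal r) := by
  have hs : 0 < β.re + 1 := by linarith
  have hr0 : 0 < r := (one_div_pos.2 hs).trans hr
  obtain ⟨u, hu, hur⟩ : ∃ u, max β.re 0 < u ∧ u < 1 / r :=
    exists_between (max_lt ((lt_div_iff₀ hr0).2 hr') (one_div_pos.2 hr0))
  obtain ⟨hβu, hu0⟩ := max_lt_iff.1 hu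
  have hus : u < β.re + 1 := hur.trans ((one_div_lt hr0 hs).2 hr)
  obtain ⟨C, hC0, hC⟩ := exists_norm_remainderTransform_le n p q hβ D
  refine memLp_of_rpow_bound (continuousOn_remainderTransform n p q hβ D)
    (C := C * (1 / (1 - (β.re + 1 - u)))) (u := u) (r := β.re + 1 - u) hr0
    ((lt_div_iff₀ hr0).1 hur) ?_ fun x hx => (hC x hx).trans ?_
  · rwa [add_sub_cancel, ← div_lt_iff₀' hs]
  · have hkernel := kernelIntegral_le_mul_rpow (u := u) (r := β.re + 1 - u) hu0.le (by linarith)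
      (by linarith) (abs_pos.2 hx)
    rw [add_sub_cancel] at hkernel
    rw [mul_assoc]
    gcongr

theorem boundedNearZero_remainderTransform_of_re_neg (hneg : β.re < 0) :
    BoundedNearZero fun x => ‖remainderTransform n p q β D x‖ := by
  obtain ⟨C, hC0, hC⟩ := exists_norm_remainderTransform_le n p q hβ D
  refine boundedNearZero_of_le (C := C * (1 / (1 - (β.re + 1)))) fun x hx => ?_
  rw [abs_norm]
  refine (hC x hx).trans ?_
  have hkernel := kernelIntegral_le_mul_rpow (u := 0) (r := β.re + 1) le_rfl (by linarith)
    (by linarith) (abs_pos.2 hx)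
  rw [zero_add, neg_zero, Real.rpow_zero, one_mul] at hkernel
  gcongr
  refine hkernel.trans (mul_le_of_le_one_right (by simpa using hneg.le) ?_)
  exact Real.rpow_le_one_of_one_le_of_nonpos (by linarith [abs_nonneg x]) (by linarith)

end Size

section Size

variable (n : ℕ) (p q : ℂ) {β : ℂ} (D : SchwartzMap ℝ ℂ)

theorem boundedNearZero_remainderTransform_of_re_pos (hpos : 0 < β.re) :
    BoundedNearZero fun x => |x| ^ β.re * ‖remainderTransform n p q β D x‖ := by
  obtain ⟨C, hC0, hC⟩ := exists_norm_remainderTransform_le n p q (by linarith) D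
  refine boundedNearZero_of_le (C := C * (1 / β.re)) fun x hx => ?_
  have hkernel := kernelIntegral_le_of_one_lt (s := β.re + 1) (by linarith) (abs_pos.2 hx)
  rw [add_sub_cancel_right, sub_add_cancel_right] at hkernel
  rw [abs_of_nonneg (by positivity)]
  calc |x| ^ β.re * ‖remainderTransform n p q β D x‖
      ≤ |x| ^ β.re * (C * (1 / β.re * |x| ^ (-β.re))) := by
        gcongr
        exact (hC x hx).trans (by gcongr)
    _ = C * (1 / β.re) * (|x| ^ β.re * |x| ^ (-β.re)) := by ring
    _ = C * (1 / β.re) := by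
        rw [← Real.rpow_add (abs_pos.2 hx), add_neg_cancel, Real.rpow_zero, mul_one]

theorem kernelIntegral_one_le {y : ℝ} (hy : 0 < y) (hy' : y < 1 / 2) :
    kernelIntegral 1 y ≤ 2 * |Real.log y| := by
  have hlog : Real.log (1 + y) ≤ -Real.log y := by
    rw [← Real.log_inv]
    refine Real.log_le_log (by positivity) ?_
    rw [← one_div, le_div_iff₀ hy]
    nlinarith
  rw [kernelIntegral_one hy, abs_of_neg (Real.log_neg hy (by linarith))]
  linarith

theorem boundedNearZero_remainderTransform_of_re_eq_zero (hzero : β.re = 0) :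
    BoundedNearZero fun x => ‖remainderTransform n p q β D x‖ / Real.log |x| := by
  obtain ⟨C, hC0, hC⟩ := exists_norm_remainderTransform_le n p q (by linarith) D
  rw [hzero, zero_add] at hC
  have hsmall : ∀ᶠ x : ℝ in 𝓝[≠] 0, |x| < 1 / 2 :=
    (continuous_abs.tendsto' (0 : ℝ) 0 abs_zero).mono_left nhdsWithin_le_nhds
      |>.eventually (gt_mem_nhds one_half_pos)
  refine ⟨C * 2, ?_⟩
  filter_upwards [hsmall, eventually_mem_nhdsWithin] with x hx hx0
  have hlog := Real.log_neg (abs_pos.2 hx0) (hx.trans one_half_lt_one)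
  rw [abs_div, abs_norm, div_le_iff₀ (abs_pos.2 hlog.ne), mul_assoc]
  exact (hC x hx0).trans (by gcongr; exact kernelIntegral_one_le (abs_pos.2 hx0) hx)

end Size

/-! ### The logarithmic case -/

theorem norm_fourierInv_sub_le {f : ℝ → ℂ} (hf : Integrable f)
    (hf' : Integrable fun ω : ℝ => (ω : ℂ) * f ω) (x : ℝ) :
    ‖fourierInv f x - fourierInv f 0‖ ≤ (∫ ω : ℝ, ‖(ω : ℂ) * f ω‖) * |x| := by
  have hsub : fourierInv f x - fourierInv f 0 =
      1 / (2 * (Real.pi : ℂ)) * ∫ ω : ℝ, f ω * (Complex.exp (Complex.I * ω * x) - 1) := by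
    have hzero : fourierInv f 0 = 1 / (2 * (Real.pi : ℂ)) * ∫ ω, f ω := by simp [fourierInv]
    rw [hzero, fourierInv, ← mul_sub, ← integral_sub (integrable_mul_exp hf x) hf]
    simp only [mul_sub, mul_one]
  rw [hsub, norm_mul, ← integral_mul_const]
  refine (mul_le_of_le_one_left (norm_nonneg _) norm_one_div_two_pi_le_one).trans
    (norm_integral_le_of_norm_le (hf'.norm.mul_const _) (ae_of_all _ fun ω => ?_))
  have hphase := Real.norm_exp_I_mul_ofReal_sub_one_le (x := ω * x)
  rw [Complex.ofReal_mul, ← mul_assoc, Real.norm_eq_abs, abs_mul] at hphase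
  rw [norm_mul, norm_mul, Complex.norm_real, Real.norm_eq_abs, mul_comm |ω|, mul_assoc ‖f ω‖]
  gcongr

theorem exists_norm_homProfile_sub_le (p q : ℂ) {β : ℂ} (hβ : -1 < β.re) (D : SchwartzMap ℝ ℂ) :
    ∃ L, ∀ x : ℝ, ‖homProfile p q β D x - homProfile p q β D 0‖ ≤ L * |x| := by
  refine ⟨_, norm_fourierInv_sub_le (integrable_mul_homMultiplier p q hβ D) ?_⟩
  have hmul (ω : ℝ) : SchwartzMap.smulLeftCLM ℂ (fun ω : ℝ => (ω : ℂ)) D ω = ω * D ω :=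
    SchwartzMap.smulLeftCLM_apply_apply (by fun_prop) D ω
  simpa only [hmul, mul_assoc] using integrable_mul_homMultiplier p q hβ
    (SchwartzMap.smulLeftCLM ℂ (fun ω : ℝ => (ω : ℂ)) D)

theorem homProfile_derivCLM_zero (p q : ℂ) (G : SchwartzMap ℝ ℂ) :
    homProfile p q 0 (SchwartzMap.derivCLM ℂ ℂ G) 0 = (q - p) / (2 * Real.pi) * G 0 := by
  have hint := (SchwartzMap.derivCLM ℂ ℂ G).integrable (μ := volume)
  have hlim := G.toZeroAtInfty.zero_at_infty'
  have hpos : ∫ ω in Ioi 0, SchwartzMap.derivCLM ℂ ℂ G ω = 0 - G 0 :=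
    integral_Ioi_of_hasDerivAt_of_tendsto' (fun ω _ => hasDerivAt_derivCLM G ω) hint.integrableOn
      (hlim.mono_left atTop_le_cocompact)
  have hneg : ∫ ω in Ioi 0, SchwartzMap.derivCLM ℂ ℂ G (-ω) = G 0 - 0 := by
    rw [integral_comp_neg_Ioi, neg_zero]
    exact integral_Iic_of_hasDerivAt_of_tendsto' (fun ω _ => hasDerivAt_derivCLM G ω)
      hint.integrableOn (hlim.mono_left atBot_le_cocompact)
  rw [homProfile_eq_integral_halfLine p q (by simp)]
  simp only [halfLineIntegrand, Complex.cpow_zero, schwartzDilate_apply, Units.val_neg,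
    Units.val_one, neg_one_mul, neg_zero, Complex.ofReal_zero, mul_zero, Complex.exp_zero, one_mul,
    mul_one, hpos, hneg]
  ring

theorem exists_norm_le_abs_mul_one_add_rpow {f : ℝ → ℂ} {L C r : ℝ} (hr : 0 ≤ r)
    (hL : ∀ y, ‖f y‖ ≤ L * |y|) (hC : ∀ y, ‖f y‖ ≤ C * (1 + |y|) ^ (-r)) :
    ∃ K, 0 ≤ K ∧ ∀ y, ‖f y‖ ≤ K * (|y| * (1 + |y|) ^ (-(r + 1))) := by
  have hL0 : 0 ≤ L := by simpa using (norm_nonneg _).trans (hL 1)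
  have hC0 : 0 ≤ C := by simpa using (norm_nonneg _).trans (hC 0)
  refine ⟨2 * (L * 2 ^ r) + 2 * C, by positivity, fun y => ?_⟩
  have hy : 0 < 1 + |y| := by positivity
  rw [neg_add, Real.rpow_add hy, Real.rpow_neg_one, ← mul_assoc, ← mul_assoc, ← div_eq_mul_inv,
    le_div_iff₀ hy]
  have : 0 ≤ (1 + |y|) ^ (-r) := by positivity
  rcases le_total |y| 1 with hy1 | hy1
  · have hone : 1 ≤ 2 ^ r * (1 + |y|) ^ (-r) := by
      rw [Real.rpow_neg hy.le, ← div_eq_mul_inv, one_le_div (by positivity)]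
      exact Real.rpow_le_rpow hy.le (by linarith) hr
    calc ‖f y‖ * (1 + |y|) ≤ L * |y| * 2 := by
          gcongr
          exacts [hL y, by linarith]
      _ ≤ L * |y| * 2 * (2 ^ r * (1 + |y|) ^ (-r)) := le_mul_of_one_le_right (by positivity) hone
      _ ≤ (2 * (L * 2 ^ r) + 2 * C) * |y| * (1 + |y|) ^ (-r) := by
          have : 0 ≤ 2 * C * |y| * (1 + |y|) ^ (-r) := by positivity
          linarith
  · calc ‖f y‖ * (1 + |y|) ≤ C * (1 + |y|) ^ (-r) * (2 * |y|) := by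
          gcongr
          exacts [hC y, by linarith]
      _ ≤ (2 * (L * 2 ^ r) + 2 * C) * |y| * (1 + |y|) ^ (-r) := by
          have : 0 ≤ 2 * (L * 2 ^ r) * |y| * (1 + |y|) ^ (-r) := by positivity
          linarith

theorem abs_mul_one_add_rpow_div_le {m t : ℝ} (hm : 0 ≤ m) (ht : t ∈ Ioc (0 : ℝ) 1) (x : ℝ) :
    t⁻¹ * (|x / t| * (1 + |x / t|) ^ (-(m + 2))) ≤
      (1 + |x|) ^ (-m) * (|x| * (t + |x|) ^ (-2 : ℝ)) := by
  have ht0 : 0 < t := ht.1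
  have hsum : 1 + |x / t| = (t + |x|) / t := by
    rw [abs_div, abs_of_pos ht0]
    field_simp
  have htwo : t⁻¹ * (|x / t| * (1 + |x / t|) ^ (-2 : ℝ)) = |x| * (t + |x|) ^ (-2 : ℝ) := by
    rw [hsum, abs_div, abs_of_pos ht0, Real.rpow_neg (by positivity), Real.rpow_neg (by positivity),
      Real.rpow_two, Real.rpow_two]
    field_simp
  have hmono : (1 + |x / t|) ^ (-m) ≤ (1 + |x|) ^ (-m) := by
    refine Real.rpow_le_rpow_of_nonpos (by positivity) ?_ (by linarith)
    rw [abs_div, abs_of_pos ht0]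
    gcongr
    exact le_div_self (abs_nonneg x) ht0 ht.2
  rw [neg_add, Real.rpow_add (by positivity), ← htwo]
  calc t⁻¹ * (|x / t| * ((1 + |x / t|) ^ (-m) * (1 + |x / t|) ^ (-2 : ℝ)))
      = (1 + |x / t|) ^ (-m) * (t⁻¹ * (|x / t| * (1 + |x / t|) ^ (-2 : ℝ))) := by ring
    _ ≤ (1 + |x|) ^ (-m) * (t⁻¹ * (|x / t| * (1 + |x / t|) ^ (-2 : ℝ))) := by gcongr

theorem abs_mul_kernelIntegral_two_le {x : ℝ} (hx : x ≠ 0) : |x| * kernelIntegral 2 |x| ≤ 1 := by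
  have hx' : 0 < |x| := abs_pos.2 hx
  have h := kernelIntegral_le_of_one_lt one_lt_two hx'
  norm_num [Real.rpow_neg_one] at h
  rwa [← le_inv_mul_iff₀ hx', mul_one]

/-- For `β = 0`, profiles vanishing at the origin escape the logarithm: the mean of their dilates
stays bounded, and inherits their decay. -/
theorem norm_dilationMean_zero_le (n : ℕ) {η : ℝ → ℂ} {K m : ℝ} (hm : 0 ≤ m)
    (hη : ∀ y, ‖η y‖ ≤ K * (|y| * (1 + |y|) ^ (-(m + 2)))) {x : ℝ} (hx : x ≠ 0) :
    ‖dilationMean n 0 η x‖ ≤ K * (1 + |x|) ^ (-m) := by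
  have hK : 0 ≤ K := nonneg_of_mul_nonneg_left ((norm_nonneg _).trans (hη 1)) (by positivity)
  have hx' : 0 < |x| := abs_pos.2 hx
  calc ‖dilationMean n 0 η x‖
      ≤ ∫ t in (0 : ℝ)..1, K * (1 + |x|) ^ (-m) * |x| * (t + |x|) ^ (-2 : ℝ) := by
        refine norm_taylorAverage_le n (fun t ht => ?_)
          ((intervalIntegrable_add_rpow hx' 2).const_mul _)
        have ht0 : 0 < t := ht.1
        rw [zero_add, Complex.cpow_neg_one, norm_mul, norm_inv, Complex.norm_real,
          Real.norm_of_nonneg ht0.le, mul_assoc, mul_assoc]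
        refine (mul_le_mul_of_nonneg_left (hη _) (inv_pos.2 ht0).le).trans ?_
        rw [mul_left_comm]
        exact mul_le_mul_of_nonneg_left (abs_mul_one_add_rpow_div_le hm ht x) hK
    _ = K * (1 + |x|) ^ (-m) * (|x| * kernelIntegral 2 |x|) := by
        rw [intervalIntegral.integral_const_mul, kernelIntegral, mul_assoc]
    _ ≤ K * (1 + |x|) ^ (-m) :=
        mul_le_of_le_one_right (by positivity) (abs_mul_kernelIntegral_two_le hx)

theorem intervalIntegrable_taylorWeight_smul_dilate (n : ℕ) {β : ℂ} {η : ℝ → ℂ} {C : ℝ}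
    (hη : Continuous η) (hC : ∀ y : ℝ, ‖η y‖ ≤ C * (1 + |y|) ^ (-(β.re + 1))) {x : ℝ}
    (hx : x ≠ 0) :
    IntervalIntegrable (fun t : ℝ => taylorWeight n t • ((t : ℂ) ^ (-(β + 1)) * η (x / t)))
      volume 0 1 := by
  refine ((intervalIntegrable_add_rpow (abs_pos.2 hx) (β.re + 1)).const_mul C).mono_fun' ?_ ?_
  · exact ((continuous_taylorWeight n).measurable.smul ((measurable_dilate β hη).comp
      (measurable_id.prodMk measurable_const))).aestronglyMeasurable
  · rw [uIoc_of_le zero_le_one]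
    filter_upwards [ae_restrict_mem measurableSet_Ioc] with t ht
    exact (norm_taylorWeight_smul_le n ht _).trans (norm_dilate_le hC ht.1 x)

theorem dilationMean_inv_one_add_abs (n : ℕ) (c : ℂ) (x : ℝ) :
    dilationMean n 0 (fun y => c * ((1 + |y|)⁻¹ : ℝ)) x =
      c * taylorAverage n fun t => ((t + |x|)⁻¹ : ℝ) := by
  rw [← taylorAverage_const_mul]
  refine taylorAverage_congr n fun t ht => ?_
  have ht0 : t ≠ 0 := ht.1.ne'
  have hsum : t + |x| = t * (1 + |x / t|) := by
    rw [abs_div, abs_of_pos ht.1]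
    field_simp
  rw [zero_add, Complex.cpow_neg_one, hsum, mul_inv, Complex.ofReal_mul, Complex.ofReal_inv t]
  ring

theorem norm_dilationMean_sub_le (n : ℕ) {η : ℝ → ℂ} (hη : Continuous η) {C K : ℝ}
    (hC : ∀ y : ℝ, ‖η y‖ ≤ C * (1 + |y|) ^ (-1 : ℝ)) {z : ℂ}
    (hK : ∀ y : ℝ, ‖η y - z * ((1 + |y|)⁻¹ : ℝ)‖ ≤ K * (|y| * (1 + |y|) ^ (-2 : ℝ)))
    {x : ℝ} (hx : x ≠ 0) :
    ‖dilationMean n 0 η x - z * taylorAverage n fun t => ((t + |x|)⁻¹ : ℝ)‖ ≤ K := by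
  have hmodel : Continuous fun y : ℝ => z * (((1 + |y|)⁻¹ : ℝ) : ℂ) := by
    have (y : ℝ) : 1 + |y| ≠ 0 := by positivity
    fun_prop (disch := exact this _)
  have hsub : dilationMean n 0 η x - z * taylorAverage n (fun t => ((t + |x|)⁻¹ : ℝ)) =
      dilationMean n 0 (fun y => η y - z * ((1 + |y|)⁻¹ : ℝ)) x := by
    rw [← dilationMean_inv_one_add_abs, dilationMean, dilationMean, taylorAverage, taylorAverage,
      ← intervalIntegral.integral_sub
        (intervalIntegrable_taylorWeight_smul_dilate n hη (by simpa using hC) hx)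
        (intervalIntegrable_taylorWeight_smul_dilate n hmodel (C := ‖z‖) (fun y => ?_) hx)]
    · simp only [← smul_sub, ← mul_sub, dilationMean, taylorAverage]
    · rw [norm_mul, Complex.norm_real, Real.norm_of_nonneg (by positivity), Complex.zero_re,
        zero_add, Real.rpow_neg_one]
  rw [hsub]
  simpa using norm_dilationMean_zero_le n le_rfl (by simpa using hK) hx

theorem exists_norm_dilationMean_sub_le (n : ℕ) {η : ℝ → ℂ} (hη : Continuous η) {C L : ℝ}
    (hC : ∀ y : ℝ, ‖η y‖ ≤ C * (1 + |y|) ^ (-1 : ℝ)) (hL : ∀ y : ℝ, ‖η y - η 0‖ ≤ L * |y|) :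
    ∃ K, ∀ x : ℝ, x ≠ 0 →
      ‖dilationMean n 0 η x - η 0 * taylorAverage n fun t => ((t + |x|)⁻¹ : ℝ)‖ ≤ K := by
  have hmodel (y : ℝ) : ‖η 0 * ((1 + |y|)⁻¹ : ℝ)‖ = ‖η 0‖ * (1 + |y|) ^ (-1 : ℝ) := by
    rw [norm_mul, Complex.norm_real, Real.norm_of_nonneg (by positivity), Real.rpow_neg_one]
  have hmodel' (y : ℝ) : ‖η 0 - η 0 * ((1 + |y|)⁻¹ : ℝ)‖ ≤ ‖η 0‖ * |y| := by
    have : 0 < 1 + |y| := by positivity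
    have hfactor : η 0 - η 0 * ((1 + |y|)⁻¹ : ℝ) = η 0 * (|y| * (1 + |y|)⁻¹ : ℝ) := by
      have : |y| * (1 + |y|)⁻¹ = 1 - (1 + |y|)⁻¹ := by
        field_simp
        ring
      rw [this]
      push_cast
      ring
    rw [hfactor, norm_mul, Complex.norm_real, Real.norm_of_nonneg (by positivity)]
    gcongr
    exact mul_le_of_le_one_right (abs_nonneg y) (inv_le_one_of_one_le₀ (by simp))
  obtain ⟨K, -, hK⟩ := exists_norm_le_abs_mul_one_add_rpow zero_le_one
    (f := fun y => η y - η 0 * ((1 + |y|)⁻¹ : ℝ)) (L := L + ‖η 0‖) (C := C + ‖η 0‖)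
    (fun y => by
      rw [add_mul]
      exact (norm_sub_le_norm_sub_add_norm_sub _ (η 0) _).trans (add_le_add (hL y) (hmodel' y)))
    (fun y => by
      rw [add_mul]
      exact (norm_sub_le _ _).trans (add_le_add (hC y) (hmodel y).le))
  rw [one_add_one_eq_two] at hK
  exact ⟨K, fun x hx => norm_dilationMean_sub_le n hη hC hK hx⟩

/-- Bernoulli's inequality `1 - n t ≤ (1 - t) ^ n` bounds the weight from below. -/
theorem kernelIntegral_one_le_taylorAverage (n : ℕ) {y : ℝ} (hy : 0 < y) :
    (kernelIntegral 1 y - n) / n.factorial ≤ (taylorAverage n fun t => ((t + y)⁻¹ : ℝ)).re := by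
  have hcont : ContinuousOn (fun t : ℝ => (t + y)⁻¹) (Icc 0 1) := fun t ht =>
    ((by fun_prop : ContinuousAt (fun t : ℝ => t + y) t).inv₀
      (add_pos_of_nonneg_of_pos ht.1 hy).ne').continuousWithinAt
  have hkernel : kernelIntegral 1 y = ∫ t in (0 : ℝ)..1, (t + y)⁻¹ := by
    simp only [kernelIntegral, Real.rpow_neg_one]
  have hreal : taylorAverage n (fun t => ((t + y)⁻¹ : ℝ)) =
      ((∫ t in (0 : ℝ)..1, taylorWeight n t * (t + y)⁻¹ : ℝ) : ℂ) := by
    rw [taylorAverage, ← intervalIntegral.integral_ofReal]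
    simp only [Complex.real_smul, Complex.ofReal_mul]
  have hint : IntervalIntegrable (fun t : ℝ => (t + y)⁻¹) volume 0 1 :=
    ContinuousOn.intervalIntegrable (by rwa [uIcc_of_le zero_le_one])
  have hsub : (kernelIntegral 1 y - n) / n.factorial =
      ∫ t in (0 : ℝ)..1, ((t + y)⁻¹ - n) / n.factorial := by
    rw [intervalIntegral.integral_div, intervalIntegral.integral_sub hint intervalIntegrable_const,
      hkernel]
    simp
  rw [hreal, Complex.ofReal_re, hsub]
  refine intervalIntegral.integral_mono_on zero_le_one
    ((hint.sub intervalIntegrable_const).div_const _)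
    (hint.continuousOn_mul (continuous_taylorWeight n).continuousOn) fun t ht => ?_
  have hty : 0 < t + y := add_pos_of_nonneg_of_pos ht.1 hy
  have hbernoulli := one_add_mul_le_pow (a := -t) (by linarith [ht.2]) n
  rw [← sub_eq_add_neg] at hbernoulli
  have hratio : n * (t * (t + y)⁻¹) ≤ n := by
    refine mul_le_of_le_one_right n.cast_nonneg ?_
    rw [← div_eq_mul_inv]
    exact div_le_one_of_le₀ (by linarith) hty.le
  rw [taylorWeight, div_mul_eq_mul_div]
  gcongr
  have := mul_le_mul_of_nonneg_right hbernoulli (inv_nonneg.2 hty.le)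
  linarith

theorem tendsto_kernelIntegral_one : Tendsto (kernelIntegral 1) (𝓝[>] 0) atTop := by
  have hlog : Tendsto (fun y : ℝ => -Real.log y) (𝓝[>] 0) atTop :=
    tendsto_neg_atBot_atTop.comp Real.tendsto_log_nhdsGT_zero
  refine tendsto_atTop_mono' _ ?_ hlog
  filter_upwards [self_mem_nhdsWithin] with y (hy : 0 < y)
  rw [kernelIntegral_one hy]
  linarith [Real.log_nonneg (by linarith : 1 ≤ 1 + y)]

theorem tendsto_norm_remainderTransform_atTop (n : ℕ) {p q : ℂ} (hpq : p ≠ q)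
    {G : SchwartzMap ℝ ℂ} (hG : G 0 ≠ 0) :
    Tendsto (fun x => ‖remainderTransform n p q 0 (SchwartzMap.derivCLM ℂ ℂ G) x‖) (𝓝[≠] 0)
      atTop := by
  set η := homProfile p q 0 (SchwartzMap.derivCLM ℂ ℂ G) with hη
  have hη0 : 0 < ‖η 0‖ := by
    rw [norm_pos_iff, hη, homProfile_derivCLM_zero]
    exact mul_ne_zero (div_ne_zero (sub_ne_zero.2 hpq.symm) (by simp [Real.pi_ne_zero])) hG
  have hre : -1 < (0 : ℂ).re := by simp
  obtain ⟨C, -, hC⟩ := exists_norm_homProfile_le p q hre (SchwartzMap.derivCLM ℂ ℂ G)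
  obtain ⟨L, hL⟩ := exists_norm_homProfile_sub_le p q hre (SchwartzMap.derivCLM ℂ ℂ G)
  obtain ⟨K, hK⟩ := exists_norm_dilationMean_sub_le n
    (continuous_homProfile p q hre (SchwartzMap.derivCLM ℂ ℂ G)) (by simpa using hC) hL
  have habs : Tendsto (fun x : ℝ => |x|) (𝓝[≠] 0) (𝓝[>] 0) := tendsto_abs_nhdsNE_zero
  have hkernel := (tendsto_kernelIntegral_one.comp habs).atTop_add
    (tendsto_const_nhds (x := -(n : ℝ)))
  refine tendsto_atTop_mono' _ ?_ (((hkernel.atTop_div_const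
    (by positivity : (0 : ℝ) < n.factorial)).const_mul_atTop hη0).atTop_add
    (tendsto_const_nhds (x := -K)))
  filter_upwards [self_mem_nhdsWithin] with x hx
  have hmodel : ‖η 0‖ * ((kernelIntegral 1 |x| - n) / n.factorial) ≤
      ‖η 0 * taylorAverage n fun t => ((t + |x|)⁻¹ : ℝ)‖ := by
    rw [norm_mul]
    gcongr
    exact (kernelIntegral_one_le_taylorAverage n (abs_pos.2 hx)).trans (Complex.re_le_norm _)
  have hdiff := norm_sub_norm_le (η 0 * taylorAverage n fun t => ((t + |x|)⁻¹ : ℝ))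
    (dilationMean n 0 η x)
  rw [norm_sub_rev] at hdiff
  have := hK x hx
  simp only [Function.comp_apply, ← sub_eq_add_neg, remainderTransform]
  linarith

theorem exists_norm_remainderTransform_le_of_pure (n : ℕ) (p : ℂ) (G : SchwartzMap ℝ ℂ) {m : ℝ}
    (hm : 0 ≤ m) : ∃ K, ∀ x : ℝ, x ≠ 0 →
      ‖remainderTransform n p p 0 (SchwartzMap.derivCLM ℂ ℂ G) x‖ ≤ K * (1 + |x|) ^ (-m) := by
  set D := SchwartzMap.derivCLM ℂ ℂ G
  have hprofile (x : ℝ) : homProfile p p 0 D x = (p • schwartzFourierInv D) x := by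
    have hsymbol : (fun ω => D ω * homMultiplier p p 0 ω) =ᵐ[volume] fun ω => p * D ω := by
      filter_upwards [Measure.ae_ne volume 0] with ω hω
      rcases hω.lt_or_gt with h | h <;> simp [homMultiplier, h, h.not_gt, mul_comm]
    rw [smul_apply, coe_schwartzFourierInv, smul_eq_mul, ← fourierInv_const_mul,
      homProfile, fourierInv, fourierInv]
    congr 1
    exact integral_congr_ae (hsymbol.mono fun ω hω => by simp only [hω])
  have hzero : homProfile p p 0 D 0 = 0 := by simp [D, homProfile_derivCLM_zero]
  obtain ⟨L, hL⟩ := exists_norm_homProfile_sub_le p p (by simp : -1 < (0 : ℂ).re) D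
  simp only [hzero, sub_zero] at hL
  obtain ⟨C, -, hC⟩ := exists_norm_schwartz_le (m + 1) (p • schwartzFourierInv D)
  simp only [← hprofile] at hC
  obtain ⟨K, -, hK⟩ := exists_norm_le_abs_mul_one_add_rpow (by linarith) hL hC
  rw [add_assoc, one_add_one_eq_two] at hK
  exact ⟨K, fun x hx => norm_dilationMean_zero_le n hm hK hx⟩

/-! ### The singularity at the origin -/

theorem exists_norm_mul_taylorMean_derivCLM_le (n : ℕ) (G : SchwartzMap ℝ ℂ) :
    ∃ M, ∀ ω : ℝ, ‖(ω : ℂ) * taylorMean n (SchwartzMap.derivCLM ℂ ℂ G) ω‖ ≤ M := by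
  obtain ⟨M, -, hM⟩ := exists_norm_schwartz_le_const G
  have hG' := (SchwartzMap.derivCLM ℂ ℂ G).continuous
  cases n with
  | zero =>
    refine ⟨M + ‖G 0‖, fun ω => ?_⟩
    rw [mul_taylorMean_zero (hasDerivAt_derivCLM G) hG']
    exact (norm_sub_le _ _).trans (add_le_add_left (hM ω) _)
  | succ n =>
    refine ⟨M + ‖G 0 / (n + 1).factorial‖, fun ω => ?_⟩
    rw [mul_taylorMean_succ n (hasDerivAt_derivCLM G) hG']
    exact (norm_sub_le _ _).trans (add_le_add_left (norm_taylorMean_le n hM ω) _)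

theorem tendsto_schwartz_atTop (G : SchwartzMap ℝ ℂ) : Tendsto G atTop (𝓝 0) :=
  G.toZeroAtInfty.zero_at_infty'.mono_left atTop_le_cocompact

theorem tendsto_taylorMean_atTop (n : ℕ) (G : SchwartzMap ℝ ℂ) :
    Tendsto (taylorMean n G) atTop (𝓝 0) := by
  obtain ⟨M, -, hM⟩ := exists_norm_schwartz_le_const G
  have hlim := intervalIntegral.tendsto_integral_filter_of_dominated_convergence
    (F := fun ω t => taylorWeight n t • G (t * ω)) (f := fun _ => 0) (μ := volume) (a := 0) (b := 1)
    (l := atTop) (fun _ => M) (Eventually.of_forall fun ω => by fun_prop)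
    (Eventually.of_forall fun ω => ae_of_all _ fun t ht =>
      (norm_taylorWeight_smul_le n (by rwa [uIoc_of_le zero_le_one] at ht) _).trans (hM _))
    intervalIntegrable_const (ae_of_all _ fun t ht => ?_)
  · rw [intervalIntegral.integral_zero] at hlim
    exact hlim
  · rw [uIoc_of_le zero_le_one] at ht
    simpa using ((tendsto_schwartz_atTop G).comp (tendsto_id.const_mul_atTop ht.1)).const_smul
      (taylorWeight n t)

theorem tendsto_mul_taylorMean_derivCLM_atTop (n : ℕ) (G : SchwartzMap ℝ ℂ) :
    Tendsto (fun ω : ℝ => (ω : ℂ) * taylorMean n (SchwartzMap.derivCLM ℂ ℂ G) ω) atTop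
      (𝓝 (-(G 0 / n.factorial))) := by
  have hG' := (SchwartzMap.derivCLM ℂ ℂ G).continuous
  cases n with
  | zero =>
    simp only [mul_taylorMean_zero (hasDerivAt_derivCLM G) hG']
    simpa using (tendsto_schwartz_atTop G).sub_const (G 0)
  | succ n =>
    simp only [mul_taylorMean_succ n (hasDerivAt_derivCLM G) hG']
    simpa using (tendsto_taylorMean_atTop n G).sub_const (G 0 / (n + 1).factorial)

theorem tendsto_integral_mul_taylorMean_derivCLM (n : ℕ) (G : SchwartzMap ℝ ℂ) {W : ℝ → ℂ}
    (hW : Integrable W) (hzero : ∀ u ≤ 0, W u = 0) :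
    Tendsto (fun R : ℝ => ∫ u : ℝ,
        ((R * u : ℝ) : ℂ) * taylorMean n (SchwartzMap.derivCLM ℂ ℂ G) (R * u) * W u) atTop
      (𝓝 (-(G 0 / n.factorial) * ∫ u, W u)) := by
  obtain ⟨M, hM⟩ := exists_norm_mul_taylorMean_derivCLM_le n G
  have hcont := continuous_taylorMean n (SchwartzMap.derivCLM ℂ ℂ G).continuous
  rw [← integral_const_mul]
  refine tendsto_integral_filter_of_dominated_convergence (fun u => M * ‖W u‖)
    (Eventually.of_forall fun R => ?_) (Eventually.of_forall fun R => ae_of_all _ fun u => ?_)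
    (hW.norm.const_mul M) (ae_of_all _ fun u => ?_)
  · exact (Continuous.aestronglyMeasurable (by fun_prop)).mul hW.1
  · rw [norm_mul]
    gcongr
    exact hM _
  · rcases le_or_gt u 0 with hu | hu
    · simp [hzero u hu]
    · exact ((tendsto_mul_taylorMean_derivCLM_atTop n G).comp
        (tendsto_id.atTop_mul_const hu)).mul_const _

theorem mul_integral_remainderSymbol_comp_mul (n : ℕ) (p q : ℂ) {β : ℂ} (hβ : -1 < β.re)
    (hβ₁ : β.re < 1) (D ψ : SchwartzMap ℝ ℂ) {R : ℝ} (hR : 0 < R) :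
    (R : ℂ) * ∫ u, remainderSymbol n p q β D (R * u) * fourierInv ψ u =
      ∫ x, remainderTransform n p q β D (x / R) * ψ x := by
  have hR0 : (R : ℂ) ≠ 0 := Complex.ofReal_ne_zero.2 hR.ne'
  obtain ⟨-, hrep⟩ := representedAt_of_lt_one n p q D hβ hβ₁
    (schwartzDilate (Units.mk0 R hR.ne') ψ)
  have hdilate : ⇑(schwartzDilate (Units.mk0 R hR.ne') ψ) = fun x => ψ (R * x) := rfl
  have hleft := Measure.integral_comp_mul_left
    (fun ω : ℝ => remainderSymbol n p q β D ω * fourierInv ψ (ω / R)) R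
  have hright := Measure.integral_comp_mul_left
    (fun x : ℝ => remainderTransform n p q β D (x / R) * ψ x) R
  simp only [mul_div_cancel_left₀ _ hR.ne', abs_of_pos (inv_pos.2 hR), Complex.real_smul,
    Complex.ofReal_inv] at hleft hright
  simp only [hdilate, fourierInv_comp_mul_left _ hR, mul_left_comm _ ((R : ℂ)⁻¹),
    integral_const_mul] at hrep
  rw [hleft, hrep, hright, mul_inv_cancel_left₀ hR0]

theorem exists_norm_le_of_tendsto {g : ℝ → ℂ} {l : ℂ} {c : ℝ} (hl : Tendsto g (𝓝[≠] 0) (𝓝 l))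
    (hc : ∀ x : ℝ, x ≠ 0 → ‖g x‖ ≤ c / |x|) : ∃ M, ∀ x : ℝ, x ≠ 0 → ‖g x‖ ≤ M := by
  have hc0 : 0 ≤ c := by simpa using (norm_nonneg _).trans (hc 1 one_ne_zero)
  have hnear : ∀ᶠ x in 𝓝[≠] (0 : ℝ), ‖g x‖ < ‖l‖ + 1 :=
    hl.norm.eventually (gt_mem_nhds (lt_add_one _))
  obtain ⟨δ, hδ, hball⟩ := Metric.eventually_nhds_iff.1 (eventually_nhdsWithin_iff.1 hnear)
  refine ⟨max (‖l‖ + 1) (c / δ), fun x hx => ?_⟩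
  rcases lt_or_ge |x| δ with hxδ | hxδ
  · exact le_max_of_le_left (hball (by simpa using hxδ) hx).le
  · exact le_max_of_le_right ((hc x hx).trans (by gcongr))

theorem tendsto_integral_comp_div_mul {g : ℝ → ℂ} (hg : AEStronglyMeasurable g) {M : ℝ}
    (hM : ∀ x : ℝ, x ≠ 0 → ‖g x‖ ≤ M) {l : ℂ} (hl : Tendsto g (𝓝[≠] 0) (𝓝 l)) {ψ : ℝ → ℂ}
    (hψ : Integrable ψ) :
    Tendsto (fun R : ℝ => ∫ x, g (x / R) * ψ x) atTop (𝓝 (l * ∫ x, ψ x)) := by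
  rw [← integral_const_mul]
  refine tendsto_integral_filter_of_dominated_convergence (fun x => M * ‖ψ x‖) ?_ ?_
    (hψ.norm.const_mul M) ?_
  · filter_upwards [eventually_gt_atTop (0 : ℝ)] with R hR
    simp only [div_eq_inv_mul]
    exact (hg.comp_quasiMeasurePreserving (Measure.quasiMeasurePreserving_smul volume
      (inv_pos.2 hR).ne')).mul hψ.1
  · filter_upwards [eventually_gt_atTop (0 : ℝ)] with R hR
    filter_upwards [Measure.ae_ne volume (0 : ℝ)] with x hx
    rw [norm_mul]
    gcongr
    exact hM _ (div_ne_zero hx hR.ne')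
  · filter_upwards [Measure.ae_ne volume (0 : ℝ)] with x hx
    refine (hl.comp (tendsto_nhdsWithin_iff.2 ⟨tendsto_const_nhds.div_atTop tendsto_id, ?_⟩)
      ).mul_const _
    filter_upwards [eventually_gt_atTop (0 : ℝ)] with R hR using div_ne_zero hx hR.ne'

section Singular

variable (n : ℕ) (p q : ℂ) {β : ℂ} (hβ : β.re = 0) (G : SchwartzMap ℝ ℂ)

include hβ

theorem integrable_inv_mul_homMultiplier_mul {θ : SchwartzMap ℝ ℂ} (hθ : ∀ u < 1, θ u = 0) :
    Integrable fun u : ℝ => (u : ℂ)⁻¹ * homMultiplier p q β u * θ u := by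
  refine (θ.integrable.norm.const_mul (‖p‖ + ‖q‖)).mono' ?_ (ae_of_all _ fun u => ?_)
  · have := measurable_homMultiplier p q β
    have := θ.continuous.measurable
    exact Measurable.aestronglyMeasurable (by fun_prop)
  · rcases lt_or_ge u 1 with hu | hu
    · simp [hθ u hu]
    · have hmul := norm_homMultiplier_le p q β u
      rw [hβ, Real.rpow_zero, mul_one] at hmul
      rw [norm_mul, norm_mul, norm_inv, Complex.norm_real, Real.norm_of_nonneg (by linarith)]
      gcongr
      exact (mul_le_of_le_one_left (norm_nonneg _) (inv_le_one_of_one_le₀ hu)).trans hmul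

/-- Blowing up around the origin turns the transform into its limit there and the symbol into its
homogeneous leading part at infinity, so the two have to match on functions whose Fourier
transform misses the origin. -/
theorem integral_inv_mul_homMultiplier_mul_eq_zero (hG : G 0 ≠ 0) {l : ℂ}
    (hl : Tendsto (remainderTransform n p q β (SchwartzMap.derivCLM ℂ ℂ G)) (𝓝[≠] 0) (𝓝 l))
    {θ : SchwartzMap ℝ ℂ} (hθ : ∀ u < 1, θ u = 0) :
    ∫ u : ℝ, (u : ℂ)⁻¹ * homMultiplier p q β u * θ u = 0 := by
  set D := SchwartzMap.derivCLM ℂ ℂ G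
  have hβ' : -1 < β.re := by linarith
  obtain ⟨ψ, rfl⟩ := schwartzFourierInv_surjective θ
  obtain ⟨c, -, hc⟩ := exists_norm_remainderTransform_le_div n p q hβ' D
  simp only [hβ, zero_add, Real.rpow_one] at hc
  obtain ⟨M, hM⟩ := exists_norm_le_of_tendsto hl hc
  have hψ : ∫ x, ψ x = 0 := by
    simpa [coe_schwartzFourierInv, fourierInv, Real.pi_ne_zero] using hθ 0 one_pos
  have htransform := tendsto_integral_comp_div_mul
    (aestronglyMeasurable_of_continuousOn_compl_zero (continuousOn_remainderTransform n p q hβ' D))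
    hM hl ψ.integrable
  have hsymbol := tendsto_integral_mul_taylorMean_derivCLM n G
    (integrable_inv_mul_homMultiplier_mul p q hβ hθ)
    fun u hu => by rw [hθ u (by linarith), mul_zero]
  have hscale : ∀ᶠ R : ℝ in atTop, ‖∫ x, remainderTransform n p q β D (x / R) * ψ x‖ =
      ‖∫ u : ℝ, ((R * u : ℝ) : ℂ) * taylorMean n D (R * u) *
        ((u : ℂ)⁻¹ * homMultiplier p q β u * schwartzFourierInv ψ u)‖ := by
    filter_upwards [eventually_gt_atTop 0] with R hR
    have hnorm : ‖(R : ℂ) ^ β‖ = 1 := by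
      rw [Complex.norm_cpow_eq_rpow_re_of_pos hR, hβ, Real.rpow_zero]
    rw [← mul_integral_remainderSymbol_comp_mul n p q hβ' (by linarith) D ψ hR,
      ← integral_const_mul, ← one_mul ‖∫ u : ℝ, (_ * _ * _ : ℂ)‖, ← hnorm, ← norm_mul,
      ← integral_const_mul]
    refine congrArg _ (integral_congr_ae ?_)
    filter_upwards [Measure.ae_ne volume (0 : ℝ)] with u hu
    rw [remainderSymbol, homMultiplier_mul_left p q β hR, coe_schwartzFourierInv]
    have := Complex.ofReal_ne_zero.2 hu
    push_cast
    field_simp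
  have hlimit := tendsto_nhds_unique (htransform.norm.congr' hscale) hsymbol.norm
  rw [hψ, mul_zero, norm_zero, eq_comm, norm_eq_zero, mul_eq_zero] at hlimit
  exact hlimit.resolve_left (neg_ne_zero.2 (div_ne_zero hG (mod_cast n.factorial_ne_zero)))

theorem singularAtZero_remainderTransform (hp : p ≠ 0) (hG : G 0 ≠ 0) :
    SingularAtZero (remainderTransform n p q β (SchwartzMap.derivCLM ℂ ℂ G)) := by
  rintro ⟨l, hl⟩
  have hcont : ContinuousOn (fun u : ℝ => (u : ℂ)⁻¹ * (p * (u : ℂ) ^ β)) (Ioi 1) := fun u hu => by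
    have hu0 : 0 < u := one_pos.trans hu
    have hinv : (u : ℂ) ≠ 0 := Complex.ofReal_ne_zero.2 hu0.ne'
    have hslit : (u : ℂ) ∈ Complex.slitPlane := Complex.ofReal_mem_slitPlane.2 hu0
    exact ContinuousAt.continuousWithinAt (by fun_prop (disch := assumption))
  have hae := isOpen_Ioi.ae_eq_zero_of_integral_contDiff_smul_eq_zero
    (hcont.locallyIntegrableOn (μ := volume) measurableSet_Ioi) fun ρ hρ hρc hρs => by
      have hzero (u : ℝ) (hu : u ≤ 1) : ρ u = 0 :=
        image_eq_zero_of_notMem_tsupport fun hmem => (hρs hmem).not_ge hu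
      have hcompact : HasCompactSupport fun u => (ρ u : ℂ) := hρc.comp_left Complex.ofReal_zero
      have hsmooth : ContDiff ℝ (⊤ : ℕ∞) fun u => (ρ u : ℂ) := Complex.ofRealCLM.contDiff.comp hρ
      rw [← integral_inv_mul_homMultiplier_mul_eq_zero n p q hβ G hG hl
        (θ := hcompact.toSchwartzMap hsmooth) fun u hu => by simp [hzero u hu.le]]
      refine integral_congr_ae (ae_of_all _ fun u => ?_)
      rcases le_or_gt u 1 with hu | hu
      · simp [hzero u hu]
      · simp [homMultiplier_of_pos p q β (one_pos.trans hu), mul_comm]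
  have hnotMem : ∀ᵐ u : ℝ, u ∉ Ioi (1 : ℝ) := hae.mono fun u hu hu1 => by
    have hu0 : (u : ℂ) ≠ 0 := Complex.ofReal_ne_zero.2 (one_pos.trans hu1).ne'
    simpa [hp, hu0, Complex.cpow_eq_zero_iff] using hu hu1
  simpa using measure_eq_zero_iff_ae_notMem.2 hnotMem

end Singular

section PureInteger

variable {a b : ℂ}

theorem isPureInteger_natCast_iff (ha : a ≠ 0) (hb : b ≠ 0) {k : ℕ} (hk : k ≠ 0) :
    IsPureInteger a b k ↔ b⁻¹ = (-1) ^ k / a := by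
  rw [eq_div_iff ha, inv_mul_eq_iff_eq_mul₀ hb]
  have hsq : ((-1 : ℂ) ^ k) * (-1) ^ k = 1 := by
    rw [← mul_pow, neg_one_mul, neg_neg, one_pow]
  constructor
  · rintro ⟨m, hm, d, hd⟩
    obtain rfl : k = m := mod_cast hm
    have hone := hd 1
    have hneg := hd (-1)
    rw [homMultiplier_of_pos _ _ _ one_pos] at hone
    rw [homMultiplier_neg_of_pos _ _ _ one_pos] at hneg
    simp only [Complex.ofReal_neg, Complex.ofReal_one, Complex.one_cpow, one_pow, mul_one]
      at hone hneg
    rw [hone, hneg]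
    linear_combination -d * hsq
  · intro h
    refine ⟨k, rfl, a, fun ω => ?_⟩
    induction ω using real_sign_cases with
    | zero => simp [hk]
    | pos ω hω => rw [homMultiplier_of_pos _ _ _ hω, Complex.cpow_natCast]
    | neg ω hω =>
      rw [homMultiplier_neg_of_pos _ _ _ hω, Complex.cpow_natCast, Complex.ofReal_neg, neg_pow, h]
      linear_combination -b * (ω : ℂ) ^ k * hsq

end PureInteger

/-! ### The adjoint integrator -/

/-- The function representing `adjIntegrator a b γ (n + 1) φ` away from the origin. -/
def integratorFun (a b γ : ℂ) (n : ℕ) (φ : SchwartzMap ℝ ℂ) : ℝ → ℂ :=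
  remainderTransform n b⁻¹ ((-1) ^ (n + 1) / a) ((n + 1 : ℕ) - γ)
    (schwartzDeriv (n + 1) (schwartzFourier φ))

theorem adjIntegrator_eq_integral_remainderSymbol (a b γ : ℂ) (n : ℕ) (φ : SchwartzMap ℝ ℂ) :
    adjIntegrator a b γ (n + 1) φ = fun ψ : SchwartzMap ℝ ℂ =>
      ∫ ω, remainderSymbol n b⁻¹ ((-1) ^ (n + 1) / a) ((n + 1 : ℕ) - γ)
        (schwartzDeriv (n + 1) (schwartzFourier φ)) ω * fourierInv ψ ω := by
  funext ψ
  simp only [adjIntegrator, adjSymbol_eq_remainderSymbol]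

section Integrator

variable (a b : ℂ) {γ : ℂ} (n : ℕ) (φ : SchwartzMap ℝ ℂ)

theorem neg_one_lt_re_natCast_sub {k : ℕ} (hγ : γ.re < k + 1) : -1 < ((k : ℂ) - γ).re := by
  rw [Complex.sub_re, Complex.natCast_re]
  linarith

theorem boundedNearZero_integratorFun_of_lt_re (hγ : (n + 1 : ℕ) < γ.re)
    (hγ₁ : γ.re < (n + 1 : ℕ) + 1) : BoundedNearZero fun x => ‖integratorFun a b γ n φ x‖ :=
  boundedNearZero_remainderTransform_of_re_neg n _ _ (neg_one_lt_re_natCast_sub hγ₁) _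
    (by simpa using hγ)

theorem boundedNearZero_integratorFun_of_re_lt (hγ : γ.re < (n + 1 : ℕ)) :
    BoundedNearZero fun x => |x| ^ ((n + 1 : ℕ) - γ.re) * ‖integratorFun a b γ n φ x‖ := by
  simpa only [integratorFun, Complex.sub_re, Complex.natCast_re] using
    boundedNearZero_remainderTransform_of_re_pos n _ _ _ (β := (n + 1 : ℕ) - γ) (by simpa using hγ)

theorem boundedNearZero_integratorFun_of_re_eq (hγ : γ.re = (n + 1 : ℕ)) :
    BoundedNearZero fun x => ‖integratorFun a b γ n φ x‖ / Real.log |x| :=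
  boundedNearZero_remainderTransform_of_re_eq_zero n _ _ _ (by simp [hγ])

section Decay

variable (hγ : γ.re < (n + 1 : ℕ) + 1)

include hγ

theorem integrable_adjSymbol_mul_fourierInv (ψ : SchwartzMap ℝ ℂ) :
    Integrable fun ω => adjSymbol a b γ (n + 1) φ ω * fourierInv ψ ω := by
  simp only [adjSymbol_eq_remainderSymbol, ← coe_schwartzFourierInv]
  exact integrable_remainderSymbol_mul n _ _ (neg_one_lt_re_natCast_sub hγ) _ _

theorem exists_temperedDistribution_adjIntegrator :
    ∃ T : TemperedDistribution ℝ ℂ, ∀ ψ, T ψ = adjIntegrator a b γ (n + 1) φ ψ := by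
  rw [adjIntegrator_eq_integral_remainderSymbol]
  exact exists_temperedDistribution_integral_remainderSymbol n _ _ (neg_one_lt_re_natCast_sub hγ) _

theorem continuousOn_integratorFun : ContinuousOn (integratorFun a b γ n φ) {0}ᶜ :=
  continuousOn_remainderTransform n _ _ (neg_one_lt_re_natCast_sub hγ) _

theorem representedAt_integratorFun_of_zero_notMem_tsupport {ψ : SchwartzMap ℝ ℂ}
    (hψ : (0 : ℝ) ∉ tsupport ψ) :
    RepresentedAt (adjIntegrator a b γ (n + 1) φ) (integratorFun a b γ n φ) ψ := by
  rw [adjIntegrator_eq_integral_remainderSymbol]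
  exact representedAt_of_zero_notMem_tsupport n _ _ _ (neg_one_lt_re_natCast_sub hγ) hψ

theorem representedAt_integratorFun (hγ' : (n + 1 : ℕ) - γ.re < 1) (ψ : SchwartzMap ℝ ℂ) :
    RepresentedAt (adjIntegrator a b γ (n + 1) φ) (integratorFun a b γ n φ) ψ := by
  rw [adjIntegrator_eq_integral_remainderSymbol]
  exact representedAt_of_lt_one n _ _ _ (neg_one_lt_re_natCast_sub hγ) (by simpa using hγ') ψ

theorem exists_norm_integratorFun_le_div : ∃ c, 0 < c ∧ ∀ x : ℝ, 1 ≤ |x| →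
    ‖integratorFun a b γ n φ x‖ ≤ c / |x| ^ ((n + 1 : ℕ) + 1 - γ.re) := by
  obtain ⟨c, hc, hle⟩ := exists_norm_remainderTransform_le_div n b⁻¹ ((-1) ^ (n + 1) / a)
    (neg_one_lt_re_natCast_sub hγ) (schwartzDeriv (n + 1) (schwartzFourier φ))
  rw [Complex.sub_re, Complex.natCast_re, sub_add_eq_add_sub] at hle
  exact ⟨c, hc, fun x hx => hle x (abs_pos.1 (one_pos.trans_le hx))⟩

theorem memLp_integratorFun {p : ℝ} (hp : 1 / ((n + 1 : ℕ) + 1 - γ.re) < p)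
    (hp' : ((n + 1 : ℕ) - γ.re) * p < 1) : MemLp (integratorFun a b γ n φ) (ENNReal.ofReal p) := by
  refine memLp_remainderTransform n _ _ (neg_one_lt_re_natCast_sub hγ) _ ?_ ?_
  · rwa [Complex.sub_re, Complex.natCast_re, sub_add_eq_add_sub]
  · rwa [Complex.sub_re, Complex.natCast_re]

theorem memLp_integratorFun_of_le_re (hγ' : (n + 1 : ℕ) ≤ γ.re) {p : ℝ}
    (hp : 1 / ((n + 1 : ℕ) + 1 - γ.re) < p) :
    MemLp (integratorFun a b γ n φ) (ENNReal.ofReal p) := by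
  have hp₀ : 0 < p := (one_div_pos.2 (sub_pos.2 hγ)).trans hp
  refine memLp_integratorFun a b n φ hγ hp (lt_of_le_of_lt ?_ one_pos)
  exact mul_nonpos_of_nonpos_of_nonneg (sub_nonpos.2 hγ') hp₀.le

end Decay

theorem memLp_integratorFun_of_re_lt (hγ : γ.re < (n + 1 : ℕ)) {p : ℝ}
    (hp : 1 / ((n + 1 : ℕ) + 1 - γ.re) < p) (hp' : p < 1 / ((n + 1 : ℕ) - γ.re)) :
    MemLp (integratorFun a b γ n φ) (ENNReal.ofReal p) :=
  memLp_integratorFun a b n φ (by linarith) hp ((lt_div_iff₀' (sub_pos.2 hγ)).1 hp')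

end Integrator

theorem integratorFun_natCast (a b : ℂ) (n : ℕ) (φ : SchwartzMap ℝ ℂ) :
    integratorFun a b (n + 1 : ℕ) n φ = remainderTransform n b⁻¹ ((-1) ^ (n + 1) / a) 0
      (SchwartzMap.derivCLM ℂ ℂ (schwartzDeriv n (schwartzFourier φ))) := by
  rw [integratorFun, sub_self, schwartzDeriv_succ]

theorem singularAtZero_integratorFun (a : ℂ) {b γ : ℂ} (hb : b ≠ 0) {n : ℕ}
    (hγ : γ.re = (n + 1 : ℕ)) (φ : SchwartzMap ℝ ℂ)
    (hφ : iteratedDeriv n (fourier φ) 0 ≠ 0) : SingularAtZero (integratorFun a b γ n φ) := by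
  rw [integratorFun, schwartzDeriv_succ]
  refine singularAtZero_remainderTransform n _ _ (by simp [hγ]) _ (inv_ne_zero hb) ?_
  rwa [coe_schwartzDeriv, coe_schwartzFourier]

section PureInteger

variable {a b : ℂ} (n : ℕ) (φ : SchwartzMap ℝ ℂ)

theorem tendsto_norm_integratorFun_atTop (ha : a ≠ 0) (hb : b ≠ 0)
    (hpure : ¬ IsPureInteger a b (n + 1 : ℕ)) (hφ : iteratedDeriv n (fourier φ) 0 ≠ 0) :
    Tendsto (fun x => ‖integratorFun a b (n + 1 : ℕ) n φ x‖) (𝓝[≠] 0) atTop := by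
  rw [isPureInteger_natCast_iff ha hb n.succ_ne_zero] at hpure
  rw [integratorFun_natCast]
  refine tendsto_norm_remainderTransform_atTop n hpure ?_
  rwa [coe_schwartzDeriv, coe_schwartzFourier]

theorem exists_norm_integratorFun_le_of_isPureInteger (ha : a ≠ 0) (hb : b ≠ 0)
    (hpure : IsPureInteger a b (n + 1 : ℕ)) {m : ℝ} (hm : 0 ≤ m) : ∃ K, ∀ x : ℝ, x ≠ 0 →
      ‖integratorFun a b (n + 1 : ℕ) n φ x‖ ≤ K * (1 + |x|) ^ (-m) := by
  rw [integratorFun_natCast, ← (isPureInteger_natCast_iff ha hb n.succ_ne_zero).1 hpure]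
  exact exists_norm_remainderTransform_le_of_pure n _ _ hm

theorem boundedNearZero_integratorFun_of_isPureInteger (ha : a ≠ 0) (hb : b ≠ 0)
    (hpure : IsPureInteger a b (n + 1 : ℕ)) :
    BoundedNearZero fun x => ‖integratorFun a b (n + 1 : ℕ) n φ x‖ := by
  obtain ⟨K, hK⟩ := exists_norm_integratorFun_le_of_isPureInteger n φ ha hb hpure le_rfl
  refine boundedNearZero_of_le (C := K) fun x hx => ?_
  simpa using hK x hx

theorem memLp_integratorFun_of_isPureInteger (ha : a ≠ 0) (hb : b ≠ 0)
    (hpure : IsPureInteger a b (n + 1 : ℕ)) {p : ℝ} (hp : 0 < p) :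
    MemLp (integratorFun a b (n + 1 : ℕ) n φ) (ENNReal.ofReal p) := by
  obtain ⟨K, hK⟩ := exists_norm_integratorFun_le_of_isPureInteger n φ ha hb hpure
    (m := 2 / p) (by positivity)
  refine memLp_of_rpow_bound (u := 0) (r := 2 / p) (C := K)
    (continuousOn_remainderTransform n _ _ (by simp) _) hp (by simp) ?_ fun x hx => ?_
  · rw [zero_add, div_mul_cancel₀ _ hp.ne']
    exact one_lt_two
  · rw [neg_zero, Real.rpow_zero, one_mul]
    exact hK x hx

end PureInteger

theorem div_rpow_le_mul_one_add_log_div {c s x : ℝ} (hc : 0 ≤ c) (hx : 1 ≤ |x|) :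
    c / |x| ^ s ≤ c * ((1 + Real.log |x|) / |x| ^ s) := by
  rw [div_eq_mul_one_div]
  gcongr
  exact le_add_of_nonneg_right (Real.log_nonneg hx)

end FracInt

end

open FracInt in
theorem mainTheorem3_general (a b γ : ℂ) (ha : a ≠ 0) (hb : b ≠ 0) (k : ℕ)
    (hk : max 1 ⌊γ.re⌋₊ ≤ k) (φ : SchwartzMap ℝ ℂ) :
    (∀ ψ : SchwartzMap ℝ ℂ,
      Integrable (fun ω : ℝ => adjSymbol a b γ k φ ω * fourierInv ψ ω)) ∧
    (∃ T : TemperedDistribution ℝ ℂ,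
      ∀ ψ : SchwartzMap ℝ ℂ, T ψ = adjIntegrator a b γ k φ ψ) ∧
    ∃ g : ℝ → ℂ, ContinuousOn g {0}ᶜ ∧
      (∀ ψ : SchwartzMap ℝ ℂ, (0 : ℝ) ∉ tsupport ψ →
        RepresentedAt (adjIntegrator a b γ k φ) g ψ) ∧
      ((k : ℝ) - γ.re < 1 → ∀ ψ : SchwartzMap ℝ ℂ,
        RepresentedAt (adjIntegrator a b γ k φ) g ψ) ∧
      ((¬ ∃ n : ℕ, γ.re = n) → k = ⌊γ.re⌋₊ →
        BoundedNearZero (fun x => ‖g x‖) ∧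
        (∀ p : ℝ, 1 / ((k : ℝ) + 1 - γ.re) < p → MemLp g (ENNReal.ofReal p) volume) ∧
        ∃ c : ℝ, 0 < c ∧ ∀ x : ℝ, 1 ≤ |x| →
          ‖g x‖ ≤ c / |x| ^ ((k : ℝ) + 1 - γ.re)) ∧
      (IsPureInteger a b γ → k = ⌊γ.re⌋₊ →
        BoundedNearZero (fun x => ‖g x‖) ∧
        ∀ p : ℝ, 0 < p → MemLp g (ENNReal.ofReal p) volume) ∧
      ((∃ n : ℕ, γ.re = n) → ¬ IsPureInteger a b γ → k = ⌊γ.re⌋₊ →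
        (iteratedDeriv (k - 1) (fourier φ) 0 ≠ 0 →
          SingularAtZero g ∧
          ((∃ n : ℕ, γ = n) → Tendsto (fun x => ‖g x‖) (𝓝[≠] (0 : ℝ)) atTop)) ∧
        BoundedNearZero (fun x => ‖g x‖ / Real.log |x|) ∧
        (∀ p : ℝ, 1 < p → MemLp g (ENNReal.ofReal p) volume) ∧
        ∃ c : ℝ, 0 < c ∧ ∀ x : ℝ, 1 ≤ |x| →
          ‖g x‖ ≤ c * ((1 + Real.log |x|) / |x|)) ∧
      ((¬ ∃ n : ℕ, γ.re = n) → ⌊γ.re⌋₊ < k →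
        BoundedNearZero (fun x => |x| ^ ((k : ℝ) - γ.re) * ‖g x‖) ∧
        (∀ p : ℝ, 1 / ((k : ℝ) + 1 - γ.re) < p → p < 1 / ((k : ℝ) - γ.re) →
          MemLp g (ENNReal.ofReal p) volume) ∧
        ∃ c : ℝ, 0 < c ∧ ∀ x : ℝ, 1 ≤ |x| →
          ‖g x‖ ≤ c / |x| ^ ((k : ℝ) + 1 - γ.re)) ∧
      ((∃ n : ℕ, γ.re = n) → ⌊γ.re⌋₊ < k →
        BoundedNearZero (fun x => |x| ^ ((k : ℝ) - γ.re) * ‖g x‖) ∧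
        (∀ p : ℝ, 1 / ((k : ℝ) + 1 - γ.re) < p → p < 1 / ((k : ℝ) - γ.re) →
          MemLp g (ENNReal.ofReal p) volume) ∧
        ∃ c : ℝ, 0 < c ∧ ∀ x : ℝ, 1 ≤ |x| →
          ‖g x‖ ≤ c * ((1 + Real.log |x|) / |x| ^ ((k : ℝ) + 1 - γ.re))) := by
  obtain ⟨n, rfl⟩ : ∃ n, k = n + 1 := ⟨k - 1, by omega⟩
  have hγ : γ.re < (n + 1 : ℕ) + 1 := (Nat.lt_floor_add_one _).trans_le
    (add_le_add_left (Nat.cast_le.2 ((le_max_right _ _).trans hk)) 1)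
  have hle (h : n + 1 = ⌊γ.re⌋₊) : (n + 1 : ℕ) ≤ γ.re :=
    (Nat.le_floor_iff' n.succ_ne_zero).1 h.le
  obtain ⟨c, hc, hdecay⟩ := exists_norm_integratorFun_le_div a b n φ hγ
  have hdecay' (x : ℝ) (hx : 1 ≤ |x|) :=
    (hdecay x hx).trans (div_rpow_le_mul_one_add_log_div hc.le hx)
  refine ⟨integrable_adjSymbol_mul_fourierInv a b n φ hγ,
    exists_temperedDistribution_adjIntegrator a b n φ hγ, integratorFun a b γ n φ,
    continuousOn_integratorFun a b n φ hγ,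
    fun ψ => representedAt_integratorFun_of_zero_notMem_tsupport a b n φ hγ,
    representedAt_integratorFun a b n φ hγ, fun hne hkγ => ?_, ?_, ?_,
    fun _ hkγ => ?_, fun _ hkγ => ?_⟩
  · have hlt := (hle hkγ).lt_of_ne fun heq => hne ⟨_, heq.symm⟩
    exact ⟨boundedNearZero_integratorFun_of_lt_re a b n φ hlt hγ,
      fun p => memLp_integratorFun_of_le_re a b n φ hγ (hle hkγ), c, hc, hdecay⟩
  · rintro ⟨m, rfl, hpow⟩ hkγ
    obtain rfl : n + 1 = m := by simpa using hkγ
    exact ⟨boundedNearZero_integratorFun_of_isPureInteger n φ ha hb ⟨_, rfl, hpow⟩,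
      fun p => memLp_integratorFun_of_isPureInteger n φ ha hb ⟨_, rfl, hpow⟩⟩
  · rintro ⟨m, hm⟩ hpure hkγ
    obtain rfl : n + 1 = m := by rw [hkγ, hm, Nat.floor_natCast]
    have hexp : ((n + 1 : ℕ) : ℝ) + 1 - γ.re = 1 := by rw [hm, add_sub_cancel_left]
    simp only [hexp, Real.rpow_one] at hdecay'
    refine ⟨fun hφ => ⟨singularAtZero_integratorFun a hb hm φ hφ, ?_⟩,
      boundedNearZero_integratorFun_of_re_eq a b n φ hm, fun p hp => ?_, c, hc, hdecay'⟩
    · rintro ⟨j, rfl⟩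
      obtain rfl : j = n + 1 := Nat.cast_injective (R := ℝ) hm
      exact tendsto_norm_integratorFun_atTop n φ ha hb hpure hφ
    · exact memLp_integratorFun_of_le_re a b n φ hγ (hle hkγ) (by rwa [hexp, div_one])
  · have hlt := Nat.lt_of_floor_lt hkγ
    exact ⟨boundedNearZero_integratorFun_of_re_lt a b n φ hlt,
      fun p => memLp_integratorFun_of_re_lt a b n φ hlt, c, hc, hdecay⟩
  · have hlt := Nat.lt_of_floor_lt hkγ
    exact ⟨boundedNearZero_integratorFun_of_re_lt a b n φ hlt,
      fun p => memLp_integratorFun_of_re_lt a b n φ hlt, c, hc, hdecay'⟩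

theorem mainTheorem3 (a b γ : ℂ) (ha : a ≠ 0) (hb : b ≠ 0) (hγ : 0 < γ.re)
    (k : ℕ) (hk : max 1 ⌊γ.re⌋₊ ≤ k) (φ : SchwartzMap ℝ ℂ) :
    -- the output is a well-defined tempered distribution
    (∀ ψ : SchwartzMap ℝ ℂ,
      Integrable (fun ω : ℝ => FracInt.adjSymbol a b γ k φ ω * FracInt.fourierInv ψ ω)) ∧
    (∃ T : TemperedDistribution ℝ ℂ,
      ∀ ψ : SchwartzMap ℝ ℂ, T ψ = FracInt.adjIntegrator a b γ k φ ψ) ∧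
    -- it is a function `g`, continuous away from `0`
    ∃ g : ℝ → ℂ, ContinuousOn g {0}ᶜ ∧
      (∀ ψ : SchwartzMap ℝ ℂ, (0 : ℝ) ∉ tsupport ψ →
        FracInt.RepresentedAt (FracInt.adjIntegrator a b γ k φ) g ψ) ∧
      ((k : ℝ) - γ.re < 1 → ∀ ψ : SchwartzMap ℝ ℂ,
        FracInt.RepresentedAt (FracInt.adjIntegrator a b γ k φ) g ψ) ∧
      -- (i)
      ((¬ ∃ n : ℕ, γ.re = n) → k = ⌊γ.re⌋₊ →
        FracInt.BoundedNearZero (fun x => ‖g x‖) ∧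
        (∀ p : ℝ, 1 / ((k : ℝ) + 1 - γ.re) < p → MemLp g (ENNReal.ofReal p) volume) ∧
        ∃ c : ℝ, 0 < c ∧ ∀ x : ℝ, 1 ≤ |x| →
          ‖g x‖ ≤ c / |x| ^ ((k : ℝ) + 1 - γ.re)) ∧
      -- (ii)
      (FracInt.IsPureInteger a b γ → k = ⌊γ.re⌋₊ →
        FracInt.BoundedNearZero (fun x => ‖g x‖) ∧
        ∀ p : ℝ, 0 < p → MemLp g (ENNReal.ofReal p) volume) ∧
      -- (iii)
      ((∃ n : ℕ, γ.re = n) → ¬ FracInt.IsPureInteger a b γ → k = ⌊γ.re⌋₊ →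
        (iteratedDeriv (k - 1) (FracInt.fourier φ) 0 ≠ 0 →
          FracInt.SingularAtZero g ∧
          ((∃ n : ℕ, γ = n) → Tendsto (fun x => ‖g x‖) (𝓝[≠] (0 : ℝ)) atTop)) ∧
        FracInt.BoundedNearZero (fun x => ‖g x‖ / Real.log |x|) ∧
        (∀ p : ℝ, 1 < p → MemLp g (ENNReal.ofReal p) volume) ∧
        ∃ c : ℝ, 0 < c ∧ ∀ x : ℝ, 1 ≤ |x| →
          ‖g x‖ ≤ c * ((1 + Real.log |x|) / |x|)) ∧
      -- (iv)
      ((¬ ∃ n : ℕ, γ.re = n) → ⌊γ.re⌋₊ < k →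
        FracInt.BoundedNearZero (fun x => |x| ^ ((k : ℝ) - γ.re) * ‖g x‖) ∧
        (∀ p : ℝ, 1 / ((k : ℝ) + 1 - γ.re) < p → p < 1 / ((k : ℝ) - γ.re) →
          MemLp g (ENNReal.ofReal p) volume) ∧
        ∃ c : ℝ, 0 < c ∧ ∀ x : ℝ, 1 ≤ |x| →
          ‖g x‖ ≤ c / |x| ^ ((k : ℝ) + 1 - γ.re)) ∧
      -- (v)
      ((∃ n : ℕ, γ.re = n) → ⌊γ.re⌋₊ < k →
        FracInt.BoundedNearZero (fun x => |x| ^ ((k : ℝ) - γ.re) * ‖g x‖) ∧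
        (∀ p : ℝ, 1 / ((k : ℝ) + 1 - γ.re) < p → p < 1 / ((k : ℝ) - γ.re) →
          MemLp g (ENNReal.ofReal p) volume) ∧
        ∃ c : ℝ, 0 < c ∧ ∀ x : ℝ, 1 ≤ |x| →
          ‖g x‖ ≤ c * ((1 + Real.log |x|) / |x| ^ ((k : ℝ) + 1 - γ.re))) :=
  mainTheorem3_general a b γ ha hb k hk φ
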